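/- Let $n\ge 1$ and let $s_1,\dots,s_{m-1}$ denote the simple reflections of $S_m$, $s_k=(k\;k{+}1)$. Let $w\in S_n$ be a Boolean permutation, i.e. a product of distinct simple reflections, and fix a reduced decomposition $w=s_{j_1}\cdots s_{j_l}$, with $j_1,\dots,j_l\in\{1,\dots,n-1\}$ distinct. For $x\in S_n$ let $\tilde x\in S_{2n}$ be given by $\tilde x(2i)=2x(i)$, $\tilde x(2i-1)=2x(i)-1$; let $\le$ be the Bruhat order. Let $\mathcal R^H$ be the set of bi-$H$-reduced elements of $S_{2n}$, i.e. those $u$ with $u(2i-1)<u(2i)$ and $u^{-1}(2i-1)<u^{-1}(2i)$ for $i=1,\dots,n$, and let $\mathcal R^H_{\le\tilde w}=\{u\in\mathcal R^H: u\le\tilde w\}$. For $A\subset B\subset\{1,\dots,l\}$ let $\overrightarrow N_A^B$ (resp. $\overleftarrow N_A^B$) be the set of $i\in B\setminus A$ for which there are $t>0$ and (necessarily unique) indices $i<i_1<\dots<i_t$ (resp. $i>i_1>\dots>i_t$) with $i_1,\dots,i_{t-1}\in A$, $i_t\in B\setminus A$ and $j_{i_k}=j_i+k$ for $k=1,\dots,t$.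 Put $N_A^B=\overrightarrow N_A^B\cup\overleftarrow N_A^B$ and $\nu_A^B(i)=i_t$ for $i\in N_A^B$. Omit $B$ from the notation when $B=\{1,\dots,l\}$. Let $\mathcal T$ be the set of triplets $(I_e,I,I_f)$ of subsets of $\{1,\dots,l\}$ with $I_f\subset I_e$ and $I\subset N_{I_f}^{I_e}$. For $u\le\tilde w$ define $\mathbf p(u)=(I_e,\overrightarrow I\cup\overleftarrow I,I_f)$, where $I_e=\{i:s_{2j_i}\le u\}$, $I_f=\{i:\widetilde{s_{j_i}}\le u\}$ and, writing $a=j_i$ and $b=j_{\nu_{I_f}(i)}$, $$\overrightarrow I=\{i\in\overrightarrow N_{I_f}: s_{2a}s_{2a+1}\,\widetilde{s_{a+1}}\,\widetilde{s_{a+2}}\cdots\widetilde{s_{b-1}}\,s_{2b}\le u\},$$ $$\overleftarrow I=\{i\in\overleftarrow N_{I_f}: s_{2b}\,\widetilde{s_{b-1}}\cdots\widetilde{s_{a+2}}\,\widetilde{s_{a+1}}\,s_{2a+1}s_{2a}\le u\}.$$ For $Q=(I_e,I,I_f)\in\mathcal T$ let $\omega_Q$ be the concatenation $\mathbf y_1\cdots\mathbf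 y_l$ of the following words in the simple reflections of $S_{2n}$: $\mathbf y_i$ is empty if $i\notin I_e$; $\mathbf y_i=s_{2j_i}s_{2j_i-1}s_{2j_i+1}s_{2j_i}$ if $i\in I_f$; $\mathbf y_i=s_{2j_i}s_{2j_i+1}$ if $i\in I\cap\overrightarrow N_{I_f}$; $\mathbf y_i=s_{2j_i+1}s_{2j_i}$ if $i\in I\cap\overleftarrow N_{I_f}$; and $\mathbf y_i=s_{2j_i}$ otherwise. Let $\mathbf q(Q)\in S_{2n}$ be the product of $\omega_Q$. Then $\mathbf p$ restricts to a bijection from $\mathcal R^H_{\le\tilde w}$ onto $\mathcal T$, whose inverse is $\mathbf q$ (in particular $\mathbf q$ maps $\mathcal T$ bijectively onto $\mathcal R^H_{\le\tilde w}$). Moreover, each word $\omega_Q$, $Q\in\mathcal T$, is reduced. -/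

import Mathlib

namespace BooleanDC

/-! Conventions. The letters `1, …, m - 1` index the simple reflections of `S_m`, as usual.
The group `S_m` is `Equiv.Perm (Fin m)`, so that the point `k ∈ {1, …, m}` is the element of
`Fin m` with value `k - 1`. Products of permutations are compositions. The group `S_{2n}` is
`Equiv.Perm (Fin (n * 2))`. -/

/-- The simple reflection `s_k` of `S_m`, `1 ≤ k ≤ m - 1`: the transposition of the `k`-th and
the `(k+1)`-st points. (It is only used for letters `k` in that range.) -/
def simpleRefl (m k : ℕ) : Equiv.Perm (Fin m) :=
  if h : 1 ≤ k ∧ k < m then Equiv.swap ⟨k - 1, by omega⟩ ⟨k, h.2⟩ else 1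

/-- The product `π(𝐯) = s_{k_1} ⋯ s_{k_r}` in `S_m` of a word `𝐯 = k_1 … k_r`. -/
def wordProd (m : ℕ) (v : List ℕ) : Equiv.Perm (Fin m) :=
  (v.map (simpleRefl m)).prod

/-- A word in the alphabet of simple reflections of `S_m`. -/
def IsWord (m : ℕ) (v : List ℕ) : Prop :=
  ∀ k ∈ v, 1 ≤ k ∧ k < m

/-- A reduced word: no word with the same product is shorter. -/
def IsReducedWord (m : ℕ) (v : List ℕ) : Prop :=
  IsWord m v ∧ ∀ v' : List ℕ, IsWord m v' → wordProd m v' = wordProd m v → v.length ≤ v'.length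

/-- A step of the Bruhat order of `S_m` (not necessarily a cover): `v = u t` for a transposition
`t = (a b)` such that `v` has larger length than `u`; for `a < b` the latter means
that `u a < u b`. -/
def BruhatStep {m : ℕ} (u v : Equiv.Perm (Fin m)) : Prop :=
  ∃ a b : Fin m, a < b ∧ u a < u b ∧ v = u * Equiv.swap a b

/-- The Bruhat order of `S_m`. -/
def BruhatLE {m : ℕ} (u v : Equiv.Perm (Fin m)) : Prop :=
  Relation.ReflTransGen BruhatStep u v

/-- The `k`-th point (`k = 0, 1`) of the `i`-th block of two consecutive points
among the `2n` points. -/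
def blockPt {n : ℕ} (i : Fin n) (k : Fin 2) : Fin (n * 2) :=
  finProdFinEquiv (i, k)

theorem blockPt_val {n : ℕ} (i : Fin n) (k : Fin 2) : (blockPt i k : ℕ) = 2 * i + k := by
  simp [blockPt, add_comm]

/-- The map `w ↦ w̃` from `S_n` to `S_{2n}` which permutes the blocks by `w` and preserves the
order inside blocks. -/
def doublePerm {n : ℕ} (w : Equiv.Perm (Fin n)) : Equiv.Perm (Fin (n * 2)) :=
  finProdFinEquiv.permCongr (w.prodCongr (Equiv.refl (Fin 2)))

theorem doublePerm_blockPt {n : ℕ} (w : Equiv.Perm (Fin n)) (i : Fin n) (k : Fin 2) :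
    doublePerm w (blockPt i k) = blockPt (w i) k := by
  simp [doublePerm, blockPt]

/-- The bi-`H`-reduced elements of `S_{2n}`. -/
def biReduced (n : ℕ) : Set (Equiv.Perm (Fin (n * 2))) :=
  {u | ∀ i : Fin n, u (blockPt i 0) < u (blockPt i 1) ∧ u⁻¹ (blockPt i 0) < u⁻¹ (blockPt i 1)}

/-- The bi-`H`-reduced elements of `S_{2n}` which are `≤ v` in the Bruhat order. -/
def biReducedBelow {n : ℕ} (v : Equiv.Perm (Fin (n * 2))) : Set (Equiv.Perm (Fin (n * 2))) :=
  {u | u ∈ biReduced n ∧ BruhatLE u v}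

section Word

variable {l : ℕ} (j : Fin l → ℕ)

/-- `i` is in the right neighbor set of `A` in `B` with respect to the word `j`, and `i'` is the
value at `i` of the neighboring function: there are `t > 0` and `i = c 0 < c 1 < ⋯ < c t = i'`
with `c 1, …, c (t-1) ∈ A`, `c t ∈ B \ A` and `j (c k) = j i + k`. -/
def IsRightNeighbor (A B : Set (Fin l)) (i i' : Fin l) : Prop :=
  i ∈ B \ A ∧ i' ∈ B \ A ∧ ∃ (t : ℕ) (c : Fin (t + 1) → Fin l), 0 < t ∧ StrictMono c ∧
    c 0 = i ∧ c (Fin.last t) = i' ∧ (∀ k, k ≠ 0 → k ≠ Fin.last t → c k ∈ A) ∧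
    ∀ k, j (c k) = j i + k

/-- The same for the left neighbor set, with `i = c 0 > c 1 > ⋯ > c t = i'`. -/
def IsLeftNeighbor (A B : Set (Fin l)) (i i' : Fin l) : Prop :=
  i ∈ B \ A ∧ i' ∈ B \ A ∧ ∃ (t : ℕ) (c : Fin (t + 1) → Fin l), 0 < t ∧ StrictAnti c ∧
    c 0 = i ∧ c (Fin.last t) = i' ∧ (∀ k, k ≠ 0 → k ≠ Fin.last t → c k ∈ A) ∧
    ∀ k, j (c k) = j i + k

variable {j} in
/-- The neighbor on either side is unique if the letters of the word are distinct. -/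
theorem neighbor_unique (hj : Function.Injective j) {A B : Set (Fin l)} {i i₁ i₂ : Fin l}
    (h₁ : IsRightNeighbor j A B i i₁ ∨ IsLeftNeighbor j A B i i₁)
    (h₂ : IsRightNeighbor j A B i i₂ ∨ IsLeftNeighbor j A B i i₂) : i₁ = i₂ := by
  have key : ∀ i', (IsRightNeighbor j A B i i' ∨ IsLeftNeighbor j A B i i') →
      i' ∉ A ∧ ∃ t : ℕ, 0 < t ∧ j i' = j i + t ∧ ∀ k, 0 < k → k < t → ∃ x ∈ A, j x = j i + k := by
    rintro i' (⟨-, h, t, c, ht, -, -, rfl, hA, hc⟩ | ⟨-, h, t, c, ht, -, -, rfl, hA, hc⟩) <;>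
    · refine ⟨h.2, t, ht, by simpa using hc (Fin.last t), fun k hk hkt => ?_⟩
      have hk' : k < t + 1 := by omega
      refine ⟨c ⟨k, hk'⟩, hA _ ?_ ?_, hc ⟨k, hk'⟩⟩ <;> simp [Fin.ext_iff] <;> omega
  obtain ⟨n₁, t₁, p₁, e₁, a₁⟩ := key _ h₁
  obtain ⟨n₂, t₂, p₂, e₂, a₂⟩ := key _ h₂
  rcases lt_trichotomy t₁ t₂ with h | h | h
  · obtain ⟨x, hx, ex⟩ := a₂ t₁ p₁ h
    exact absurd (hj (ex.trans e₁.symm) ▸ hx) n₁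
  · exact hj (by omega)
  · obtain ⟨x, hx, ex⟩ := a₁ t₂ p₂ h
    exact absurd (hj (ex.trans e₂.symm) ▸ hx) n₂

/-- The right neighbor set of `A` in `B`. -/
def rightNbrs (A B : Set (Fin l)) : Set (Fin l) := {i | ∃ i', IsRightNeighbor j A B i i'}

/-- The left neighbor set of `A` in `B`. -/
def leftNbrs (A B : Set (Fin l)) : Set (Fin l) := {i | ∃ i', IsLeftNeighbor j A B i i'}

/-- The neighbor set of `A` in `B`. -/
def nbrs (A B : Set (Fin l)) : Set (Fin l) := rightNbrs j A B ∪ leftNbrs j A B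

/-- Triplets `(I_e, I, I_f)` of sets of positions in the word. -/
@[ext] structure Triplet (l : ℕ) where
  Ie : Set (Fin l)
  I : Set (Fin l)
  If : Set (Fin l)

/-- The set `𝒯` of triplets with `I_f ⊆ I_e` and `I` contained in the neighbor set of
`I_f` in `I_e`. -/
def triplets : Set (Triplet l) := {Q | Q.If ⊆ Q.Ie ∧ Q.I ⊆ nbrs j Q.If Q.Ie}

/-- The permutation `s_{2a} s_{2a+1} s̃_{a+1} ⋯ s̃_{b-1} s_{2b}` of `S_{2n}`, for `a < b`. -/
def rightTest (n a b : ℕ) : Equiv.Perm (Fin (n * 2)) :=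
  simpleRefl (n * 2) (2 * a) * simpleRefl (n * 2) (2 * a + 1) *
    ((List.range' (a + 1) (b - a - 1)).map fun k => doublePerm (simpleRefl n k)).prod *
    simpleRefl (n * 2) (2 * b)

/-- The permutation `s_{2b} s̃_{b-1} ⋯ s̃_{a+1} s_{2a+1} s_{2a}` of `S_{2n}`, for `a < b`. -/
def leftTest (n a b : ℕ) : Equiv.Perm (Fin (n * 2)) :=
  simpleRefl (n * 2) (2 * b) *
    ((List.range' (a + 1) (b - a - 1)).reverse.map fun k => doublePerm (simpleRefl n k)).prod *
    simpleRefl (n * 2) (2 * a + 1) * simpleRefl (n * 2) (2 * a)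

/-- The set `{i : s_{2 j_i} ≤ u}`. -/
def setE {n : ℕ} (u : Equiv.Perm (Fin (n * 2))) : Set (Fin l) :=
  {i | BruhatLE (simpleRefl (n * 2) (2 * j i)) u}

/-- The set `{i : s̃_{j_i} ≤ u}`. -/
def setF {n : ℕ} (u : Equiv.Perm (Fin (n * 2))) : Set (Fin l) :=
  {i | BruhatLE (doublePerm (simpleRefl n (j i))) u}

/-- The right neighbors `i` of `I_f` (with neighbor `i'`) whose test element is `≤ u`. -/
def setRight {n : ℕ} (u : Equiv.Perm (Fin (n * 2))) : Set (Fin l) :=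
  {i | ∃ i', IsRightNeighbor j (setF j u) Set.univ i i' ∧ BruhatLE (rightTest n (j i) (j i')) u}

/-- The left neighbors `i` of `I_f` (with neighbor `i'`) whose test element is `≤ u`. -/
def setLeft {n : ℕ} (u : Equiv.Perm (Fin (n * 2))) : Set (Fin l) :=
  {i | ∃ i', IsLeftNeighbor j (setF j u) Set.univ i i' ∧ BruhatLE (leftTest n (j i) (j i')) u}

/-- The map `𝐩`. -/
def pMap {n : ℕ} (u : Equiv.Perm (Fin (n * 2))) : Triplet l where
  Ie := setE j u
  I := setRight j u ∪ setLeft j u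
  If := setF j u

open Classical in
/-- The subword `𝐲_i` of `ω_Q`. -/
noncomputable def letterBlock (Q : Triplet l) (i : Fin l) : List ℕ :=
  if i ∉ Q.Ie then []
  else if i ∈ Q.If then [2 * j i, 2 * j i - 1, 2 * j i + 1, 2 * j i]
  else if i ∈ Q.I ∩ rightNbrs j Q.If Set.univ then [2 * j i, 2 * j i + 1]
  else if i ∈ Q.I ∩ leftNbrs j Q.If Set.univ then [2 * j i + 1, 2 * j i]
  else [2 * j i]

/-- The word `ω_Q = 𝐲_1 ⋯ 𝐲_l`. -/
noncomputable def omegaWord (Q : Triplet l) : List ℕ :=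
  (List.finRange l).flatMap (letterBlock j Q)

/-- The map `𝐪`, `Q ↦ π(ω_Q)`. -/
noncomputable def qMap (n : ℕ) (Q : Triplet l) : Equiv.Perm (Fin (n * 2)) :=
  wordProd (n * 2) (omegaWord j Q)

end Word

end BooleanDC

namespace BooleanDC

open Finset Equiv

/-! The proof works with block ranks: `blk u p q` counts the points outside the first `q` blocks
that `u` sends into the first `p` blocks. By the rank criterion `bruhatLE_iff_rk_le`, Bruhat
comparison is entrywise comparison of rank matrices. If the smaller element is bi-reduced, only the
even rows and columns matter, so comparison reduces to the block ranks of `u` and `u⁻¹` with `p ≤ q`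
(`bruhatLE_of_blk_le`). Bi-reduced elements are thus determined by block ranks.

Since letters differing by at least 2 commute, a Boolean product can be assembled by increasing
letters: the factor at `k` goes on the right or on the left according to its position relative to
the letter `k - 1` (`build`). Each new factor changes block ranks by an explicit rule (`chainRank`),
and a direction change ends a chain of positive ranks. For `𝐪 Q`, the extra reflection `s_{2a+1}`
attached to a position in `I` passes through the double factors `s̃` until it reaches the
neighboring letter `b`, where it becomes `s_{2b-1}` and forms a cyclic factor with `s_{2b}`
(`partialProd_eq`). So `𝐪 Q` is such an assembled product. Its block ranks show that it is
bi-reduced and lies below `w̃`, the product with all factors double. Its number of inversions equals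
the length of `ω_Q`, which is therefore reduced.

The map `𝐩` also reads off block ranks. The tests for `I_e` and `I_f` say that the diagonal rank at
the letter is at least 1, resp. 2. The test between neighbors `a < b` says that the rank at `(a, b)`
of `u`, or of `u⁻¹` for left neighbors, is positive. This gives `𝐩 ∘ 𝐪 = id` (`pMap_qMap`).
Conversely, for `u ≤ w̃` supermodularity of block ranks shows that these data determine all of them
(`ChainBounded.blk_le_blk`), so `𝐩` is injective on the bi-reduced elements below `w̃`. An injective
map with a right inverse is a bijection. -/

theorem apply_inv_apply {α : Type*} (u : Perm α) (a : α) : u (u⁻¹ a) = a :=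
  u.apply_symm_apply a

theorem inv_apply_apply {α : Type*} (u : Perm α) (a : α) : u⁻¹ (u a) = a :=
  u.symm_apply_apply a

/-! ### Rank matrices and the Bruhat order -/

/-- The number of `i ≥ x` with `u i < y` (points are numbered from `0`). -/
def rk {m : ℕ} (u : Perm (Fin m)) (x y : ℕ) : ℕ :=
  ∑ i : Fin m, if x ≤ (i : ℕ) ∧ (u i : ℕ) < y then 1 else 0

/-- The number of `i < x` with `y ≤ u i`. -/
def ck {m : ℕ} (u : Perm (Fin m)) (x y : ℕ) : ℕ :=
  ∑ i : Fin m, if (i : ℕ) < x ∧ y ≤ (u i : ℕ) then 1 else 0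

theorem sum_val_lt (m x : ℕ) : (∑ i : Fin m, if (i : ℕ) < x then 1 else 0) = min x m := by
  rw [Fin.sum_univ_eq_sum_range (fun i => if i < x then 1 else 0), Finset.sum_boole]
  have : (range m).filter (· < x) = range (min x m) := by ext; simp; omega
  simp [this]

theorem sum_perm_val_lt {m : ℕ} (u : Perm (Fin m)) (y : ℕ) :
    (∑ i : Fin m, if (u i : ℕ) < y then 1 else 0) = min y m := by
  rw [← sum_val_lt m y, ← Equiv.sum_comp u fun i : Fin m => if (i : ℕ) < y then 1 else 0]

/-- Both sides count the points `i` with `i < x` or `u i < y`. The minima allow `x` and `y` to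
exceed `m`. -/
theorem rk_add_min {m : ℕ} (u : Perm (Fin m)) (x y : ℕ) :
    rk u x y + min x m = ck u x y + min y m := by
  rw [← sum_perm_val_lt u y, ← sum_val_lt m x, rk, ck, ← sum_add_distrib, ← sum_add_distrib]
  refine sum_congr rfl fun i _ => ?_
  split_ifs <;> omega

theorem ck_eq_rk_inv {m : ℕ} (u : Perm (Fin m)) (x y : ℕ) : ck u x y = rk u⁻¹ y x := by
  rw [ck, rk, ← Equiv.sum_comp u fun i : Fin m => if y ≤ (i : ℕ) ∧ (u⁻¹ i : ℕ) < x then 1 else 0]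
  refine sum_congr rfl fun i _ => ?_
  simp [and_comm]

theorem sum_mul_swap {m : ℕ} (u : Perm (Fin m)) {a b : Fin m} (hab : a ≠ b)
    (g : Fin m → Fin m → ℕ) :
    (∑ i, g i ((u * swap a b) i)) + g a (u a) + g b (u b) =
      (∑ i, g i (u i)) + g a (u b) + g b (u a) := by
  have key : ∀ f : Fin m → ℕ, ∑ i, f i = f a + f b + ∑ i ∈ univ \ {a, b}, f i := by
    intro f
    rw [← sum_sdiff (subset_univ {a, b}), sum_pair hab, add_comm]
  rw [key fun i => g i ((u * swap a b) i), key fun i => g i (u i)]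
  have : ∑ i ∈ univ \ {a, b}, g i ((u * swap a b) i) = ∑ i ∈ univ \ {a, b}, g i (u i) := by
    refine sum_congr rfl fun i hi => ?_
    simp only [mem_sdiff, mem_univ, true_and, mem_insert, mem_singleton, not_or] at hi
    rw [Perm.mul_apply, swap_apply_of_ne_of_ne hi.1 hi.2]
  rw [this]
  simp only [Perm.mul_apply, swap_apply_left, swap_apply_right]
  ring

/-- The effect of a Bruhat step on ranks. -/
theorem rk_mul_swap {m : ℕ} (u : Perm (Fin m)) {a b : Fin m} (hab : a < b) (hu : u a < u b)
    (x y : ℕ) : rk (u * swap a b) x y =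
      rk u x y + if (a : ℕ) < x ∧ x ≤ b ∧ (u a : ℕ) < y ∧ y ≤ u b then 1 else 0 := by
  have h := sum_mul_swap u hab.ne fun i k => if x ≤ (i : ℕ) ∧ (k : ℕ) < y then 1 else 0
  have hab' : (a : ℕ) < b := hab
  have hu' : (u a : ℕ) < u b := hu
  rw [rk, rk]
  by_cases h1 : x ≤ (a : ℕ) <;> by_cases h2 : x ≤ (b : ℕ) <;>
  by_cases h3 : (u a : ℕ) < y <;> by_cases h4 : (u b : ℕ) < y <;>
  simp only [h1, h2, h3, h4, and_true, and_false, if_true, if_false] at h <;>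
  split_ifs <;> omega

theorem BruhatStep.rk_le {m : ℕ} {u v : Perm (Fin m)} (h : BruhatStep u v) (x y : ℕ) :
    rk u x y ≤ rk v x y := by
  obtain ⟨a, b, hab, hu, rfl⟩ := h
  rw [rk_mul_swap u hab hu]
  omega

theorem BruhatLE.rk_le {m : ℕ} {u v : Perm (Fin m)} (h : BruhatLE u v) (x y : ℕ) :
    rk u x y ≤ rk v x y := by
  induction h with
  | refl => rfl
  | tail _ h ih => exact ih.trans (h.rk_le x y)

theorem rk_succ {m : ℕ} (u : Perm (Fin m)) (i : Fin m) (y : ℕ) :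
    rk u i y = rk u (i + 1) y + if (u i : ℕ) < y then 1 else 0 := by
  have : ∀ k : Fin m, (if (i : ℕ) ≤ k ∧ (u k : ℕ) < y then 1 else 0) =
      (if (i : ℕ) + 1 ≤ k ∧ (u k : ℕ) < y then 1 else 0) +
        if k = i then (if (u i : ℕ) < y then 1 else 0) else 0 := by
    intro k
    by_cases hk : k = i
    · subst hk; simp
    · have : (k : ℕ) ≠ i := fun h => hk (Fin.ext h)
      simp only [hk, if_false, add_zero]
      congr 1
      apply propext
      constructor <;> rintro ⟨h, h'⟩ <;> exact ⟨by omega, h'⟩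
  simp only [rk]
  rw [sum_congr rfl fun k _ => this k, sum_add_distrib]
  simp

theorem ck_succ {m : ℕ} (u : Perm (Fin m)) (i : Fin m) (y : ℕ) :
    ck u (i + 1) y = ck u i y + if y ≤ (u i : ℕ) then 1 else 0 := by
  have h1 := rk_succ u i y
  have h2 := rk_add_min u i y
  have h3 := rk_add_min u (i + 1) y
  have := i.2
  split_ifs at * <;> omega

theorem eq_of_rk_eq {m : ℕ} {u v : Perm (Fin m)} (h : ∀ x y, rk u x y = rk v x y) : u = v := by
  ext i
  have key : ∀ y, (u i : ℕ) < y ↔ (v i : ℕ) < y := by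
    intro y
    have h1 := rk_succ u i y
    have h2 := rk_succ v i y
    rw [h, h (i + 1)] at h1
    split_ifs at * <;> first | tauto | omega
  have h1 := key (u i + 1)
  have h2 := key (v i + 1)
  omega

theorem ck_le_of_rk_le {m : ℕ} {u v : Perm (Fin m)} (h : ∀ x y, rk u x y ≤ rk v x y) (x y : ℕ) :
    ck u x y ≤ ck v x y := by
  have h1 := rk_add_min u x y
  have h2 := rk_add_min v x y
  have := h x y
  omega

/-- At the first place `a` where `u` and `v` differ, the inequality forces `u a < v a`. Exchanging
with the first later `b` such that `u a < u b ≤ v a` stays below `v`. The bounds on the strictly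
increased entry keep it inside the finite box used for termination. -/
theorem exists_step_of_rk_le {m : ℕ} {u v : Perm (Fin m)} (h : ∀ x y, rk u x y ≤ rk v x y)
    (hne : u ≠ v) : ∃ u', BruhatStep u u' ∧ (∀ x y, rk u' x y ≤ rk v x y) ∧
      (∃ x y, x < m ∧ y < m + 1 ∧ rk u x y < rk u' x y) := by
  have hc := ck_le_of_rk_le h
  have hex : ∃ a, u a ≠ v a := by
    by_contra hcon
    push Not at hcon
    exact hne (Equiv.ext hcon)
  obtain ⟨a, ha, hmin⟩ : ∃ a, u a ≠ v a ∧ ∀ i < a, u i = v i := by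
    obtain ⟨a, ha, hmin⟩ := WellFounded.has_min (wellFounded_lt (α := Fin m)) {a | u a ≠ v a} hex
    exact ⟨a, ha, fun i hi => by_contra fun hn => hmin i hn hi⟩
  have hceq : ∀ y, ck u a y = ck v a y := by
    intro y
    refine sum_congr rfl fun i _ => ?_
    by_cases hi : i < a
    · rw [hmin i hi]
    · have : ¬ (i : ℕ) < a := hi
      simp [this]
  have hlt : u a < v a := by
    have h1 := ck_succ u a (u a)
    have h2 := ck_succ v a (u a)
    have h3 := hc (a + 1) (u a)
    rw [hceq] at h1
    have h4 : (u a : ℕ) ≠ v a := fun h => ha (Fin.ext h)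
    have : (u a : ℕ) < v a := by
      split_ifs at * <;> omega
    exact this
  obtain ⟨b, ⟨hab, hub, hbv⟩, hbmin⟩ : ∃ b, (a < b ∧ u a < u b ∧ u b ≤ v a) ∧
      ∀ i, a < i → i < b → ¬ (u a < u i ∧ u i ≤ v a) := by
    have hex : ∃ b, a < b ∧ u a < u b ∧ u b ≤ v a := by
      -- The position of the value `v a` in `u` qualifies: it cannot precede `a`, since `u` and `v`
      -- agree there.
      refine ⟨u⁻¹ (v a), ?_, by simpa using hlt, by simp⟩
      by_contra hcon
      rcases lt_or_eq_of_le (not_lt.1 hcon) with h' | h'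
      · have := hmin _ h'
        rw [apply_inv_apply] at this
        exact h'.ne' (v.injective this)
      · exact ha (by rw [← apply_inv_apply u (v a), h'])
    obtain ⟨b, hb, hbm⟩ := WellFounded.has_min (wellFounded_lt (α := Fin m))
      {b | a < b ∧ u a < u b ∧ u b ≤ v a} hex
    exact ⟨b, hb, fun i hi hib hn => hbm i ⟨hi, hn.1, hn.2⟩ hib⟩
  refine ⟨u * swap a b, ⟨a, b, hab, hub, rfl⟩, fun x y => ?_, b, u b, b.2, by omega, ?_⟩
  · rw [rk_mul_swap u hab hub]
    split_ifs with hxy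
    -- Only entries in this rectangle increase, by 1. By minimality of `b`, the points of `u` before
    -- `x` with value in `[y, v a]` all lie before `a`; there `v` has the same points, and it has
    -- the further point `a`.
    · obtain ⟨hax, hxb, hay, hyb⟩ := hxy
      have e1 := rk_add_min u x y
      have e2 := rk_add_min v x y
      have e3 := hc x (v a + 1)
      suffices ck u x y + 1 ≤ ck v x y by omega
      -- split off the points with value in `[y, v a]`
      have s1 : ck u x y = ck u x (v a + 1) +
          ∑ i, if i < a ∧ y ≤ (u i : ℕ) ∧ u i ≤ v a then 1 else 0 := by
        rw [ck, ck, ← sum_add_distrib]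
        refine sum_congr rfl fun i _ => ?_
        have hbm := hbmin i
        have hbv' : (u b : ℕ) ≤ v a := hbv
        rcases lt_trichotomy i a with hi | rfl | hi
        · have : (i : ℕ) < a := hi
          simp only [Fin.lt_def, Fin.le_def] at *
          split_ifs <;> omega
        · simp only [Fin.lt_def, Fin.le_def] at *
          split_ifs <;> omega
        · simp only [Fin.lt_def, Fin.le_def] at *
          split_ifs <;> omega
      have s2 : ck v x (v a + 1) + (∑ i, if i < a ∧ y ≤ (u i : ℕ) ∧ u i ≤ v a then 1 else 0) + 1 ≤
          ck v x y := by
        have : (1 : ℕ) = ∑ i : Fin m, if i = a then 1 else 0 := by simp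
        rw [ck, ck, ← sum_add_distrib]
        conv_lhs => rw [this]
        rw [← sum_add_distrib]
        refine sum_le_sum fun i _ => ?_
        have hbv' : (u b : ℕ) ≤ v a := hbv
        rcases lt_trichotomy i a with hi | rfl | hi
        · have hi' := hi.ne
          have := hmin i hi
          simp only [Fin.lt_def, Fin.le_def, hi', if_false, this] at *
          split_ifs <;> omega
        · simp only [Fin.lt_def, Fin.le_def, if_true] at *
          split_ifs <;> omega
        · have hi' := hi.ne'
          simp only [Fin.lt_def, Fin.le_def, hi', if_false] at *
          split_ifs <;> omega
      omega
    · simpa using h x y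
  · rw [rk_mul_swap u hab hub, if_pos]
    · omega
    · exact ⟨hab, le_rfl, hub, le_rfl⟩

/-- The rank matrix criterion for the Bruhat order. -/
theorem bruhatLE_iff_rk_le {m : ℕ} {u v : Perm (Fin m)} :
    BruhatLE u v ↔ ∀ x y, rk u x y ≤ rk v x y := by
  refine ⟨fun h => h.rk_le, fun h => ?_⟩
  -- The sum of ranks strictly increases along the steps and is bounded by its value at `v`.
  let S : Perm (Fin m) → ℕ := fun u => ∑ x ∈ range (m + 1), ∑ y ∈ range (m + 1), rk u x y
  induction hN : S v - S u using Nat.strong_induction_on generalizing u with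
  | _ N ih =>
    by_cases hne : u = v
    · exact hne ▸ Relation.ReflTransGen.refl
    obtain ⟨u', hs, hle, x, y, hx, hy, hlt⟩ := exists_step_of_rk_le h hne
    refine Relation.ReflTransGen.head hs (ih (S v - S u') ?_ hle rfl)
    have h1 : S u < S u' := by
      refine sum_lt_sum (fun x _ => sum_le_sum fun y _ => hs.rk_le x y)
        ⟨x, mem_range.2 (by omega), sum_lt_sum (fun y _ => hs.rk_le x y)
          ⟨y, mem_range.2 hy, hlt⟩⟩
    have h2 : S u' ≤ S v := sum_le_sum fun x _ => sum_le_sum fun y _ => hle x y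
    omega

theorem BruhatLE.inv {m : ℕ} {u v : Perm (Fin m)} (h : BruhatLE u v) : BruhatLE u⁻¹ v⁻¹ := by
  rw [bruhatLE_iff_rk_le] at h ⊢
  intro x y
  rw [← ck_eq_rk_inv, ← ck_eq_rk_inv]
  exact ck_le_of_rk_le h y x

theorem BruhatLE.antisymm {m : ℕ} {u v : Perm (Fin m)} (h : BruhatLE u v) (h' : BruhatLE v u) :
    u = v :=
  eq_of_rk_eq fun x y => (h.rk_le x y).antisymm (h'.rk_le x y)

/-! ### Permutations as functions on the natural numbers -/

/-- The action of a permutation of `Fin m` on `ℕ`, trivial outside `[0, m)`. -/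
def val {m : ℕ} (u : Perm (Fin m)) (x : ℕ) : ℕ :=
  if h : x < m then u ⟨x, h⟩ else x

theorem val_fin {m : ℕ} (u : Perm (Fin m)) (i : Fin m) : val u i = u i := by
  simp [val]

theorem val_of_le {m : ℕ} (u : Perm (Fin m)) {x : ℕ} (h : m ≤ x) : val u x = x := by
  simp [val, h]

theorem val_one {m : ℕ} (x : ℕ) : val (1 : Perm (Fin m)) x = x := by
  simp [val]

theorem val_mul {m : ℕ} (u v : Perm (Fin m)) (x : ℕ) : val (u * v) x = val u (val v x) := by
  by_cases h : x < m
  · simp [val, h]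
  · rw [val_of_le _ (not_lt.1 h), val_of_le v (not_lt.1 h), val_of_le u (not_lt.1 h)]

theorem val_val_inv {m : ℕ} (u : Perm (Fin m)) (x : ℕ) : val u (val u⁻¹ x) = x := by
  rw [← val_mul, mul_inv_cancel, val_one]

theorem val_inv_val {m : ℕ} (u : Perm (Fin m)) (x : ℕ) : val u⁻¹ (val u x) = x := by
  rw [← val_mul, inv_mul_cancel, val_one]

theorem val_injective {m : ℕ} (u : Perm (Fin m)) : Function.Injective (val u) :=
  Function.LeftInverse.injective (val_inv_val u)

theorem val_inv_eq_iff {m : ℕ} (u : Perm (Fin m)) {x y : ℕ} : val u⁻¹ x = y ↔ val u y = x :=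
  ⟨fun h => h ▸ val_val_inv u x, fun h => h ▸ val_inv_val u y⟩

theorem ext_val {m : ℕ} {u v : Perm (Fin m)} (h : ∀ x, val u x = val v x) : u = v := by
  ext i
  rw [← val_fin, ← val_fin, h]

theorem val_simpleRefl {m k : ℕ} (h1 : 1 ≤ k) (h2 : k < m) (x : ℕ) :
    val (simpleRefl m k) x = if x = k - 1 then k else if x = k then k - 1 else x := by
  by_cases hx : x < m
  · simp only [val, hx, simpleRefl, h1, h2, dif_pos, and_self, swap_apply_def, Fin.ext_iff]
    split_ifs <;> rfl
  · rw [val_of_le _ (not_lt.1 hx)]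
    split_ifs <;> omega

theorem rk_eq_sum_range {m : ℕ} (u : Perm (Fin m)) (x y : ℕ) :
    rk u x y = ∑ i ∈ range m, if x ≤ i ∧ val u i < y then 1 else 0 := by
  rw [rk, ← Fin.sum_univ_eq_sum_range (fun i => if x ≤ i ∧ val u i < y then 1 else 0)]
  simp only [val_fin]

theorem rk_succ_nat {m : ℕ} (u : Perm (Fin m)) {x : ℕ} (hx : x < m) (y : ℕ) :
    rk u x y = rk u (x + 1) y + if val u x < y then 1 else 0 := by
  rw [rk_succ u ⟨x, hx⟩ y, ← val_fin]

theorem rk_eq_zero_of_le {m : ℕ} (u : Perm (Fin m)) {x : ℕ} (hx : m ≤ x) (y : ℕ) :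
    rk u x y = 0 :=
  sum_eq_zero fun i _ => if_neg fun h => by omega

theorem ck_eq_zero_of_le {m : ℕ} (u : Perm (Fin m)) (x : ℕ) {y : ℕ} (hy : m ≤ y) :
    ck u x y = 0 :=
  sum_eq_zero fun i _ => if_neg fun h => by omega

theorem rk_anti {m : ℕ} (u : Perm (Fin m)) {x x' : ℕ} (h : x ≤ x') (y : ℕ) :
    rk u x' y ≤ rk u x y :=
  sum_le_sum fun i _ => by split_ifs <;> omega

theorem rk_mono {m : ℕ} (u : Perm (Fin m)) (x : ℕ) {y y' : ℕ} (h : y ≤ y') :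
    rk u x y ≤ rk u x y' :=
  sum_le_sum fun i _ => by split_ifs <;> omega

/-! ### Bi-reduced elements and block ranks -/

theorem mem_biReduced_iff {n : ℕ} {u : Perm (Fin (n * 2))} : u ∈ biReduced n ↔
    ∀ r < n, val u (2 * r) < val u (2 * r + 1) ∧ val u⁻¹ (2 * r) < val u⁻¹ (2 * r + 1) := by
  have key : ∀ (v : Perm (Fin (n * 2))) (i : Fin n),
      v (blockPt i 0) < v (blockPt i 1) ↔ val v (2 * i) < val v (2 * i + 1) := by
    intro v i
    have h0 := val_fin v (blockPt i 0)
    have h1 := val_fin v (blockPt i 1)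
    rw [blockPt_val] at h0 h1
    simp only [Fin.val_zero, Fin.val_one, add_zero] at h0 h1
    rw [h0, h1, Fin.lt_def]
  simp only [biReduced, Set.mem_ofPred_eq, key]
  exact ⟨fun h r hr => h ⟨r, hr⟩, fun h i => h i i.2⟩

theorem inv_mem_biReduced {n : ℕ} {u : Perm (Fin (n * 2))} (h : u ∈ biReduced n) :
    u⁻¹ ∈ biReduced n := by
  rw [mem_biReduced_iff] at h ⊢
  intro r hr
  rw [inv_inv]
  exact (h r hr).symm

/-- The number of points outside the first `q` blocks which are mapped to the first `p` blocks. -/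
def blk {n : ℕ} (u : Perm (Fin (n * 2))) (p q : ℕ) : ℕ := rk u (2 * q) (2 * p)

/-- For odd `x = 2r + 1`, monotonicity of `t` on the block leaves two cases. If `t (2r + 1) < y`,
then also `t (2r) < y`, and the bound follows from row `2r`, as the rank of `u` drops by at most 1.
Otherwise the rank of `t` equals that in row `2r + 2`. -/
theorem rk_le_of_even_left {n : ℕ} {t u : Perm (Fin (n * 2))} (ht : t ∈ biReduced n) {y : ℕ}
    (h : ∀ q, rk t (2 * q) y ≤ rk u (2 * q) y) (x : ℕ) : rk t x y ≤ rk u x y := by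
  rcases Nat.even_or_odd' x with ⟨r, rfl | rfl⟩
  · exact h r
  by_cases hr : r < n
  · have h1 := h r
    have h2 := h (r + 1)
    have h3 := ((mem_biReduced_iff.1 ht) r hr).1
    have e1 := rk_succ_nat t (show 2 * r < n * 2 by omega) y
    have e2 := rk_succ_nat t (show 2 * r + 1 < n * 2 by omega) y
    have e3 := rk_succ_nat u (show 2 * r < n * 2 by omega) y
    have e4 := rk_succ_nat u (show 2 * r + 1 < n * 2 by omega) y
    rw [show 2 * r + 1 + 1 = 2 * (r + 1) by ring] at *
    split_ifs at * <;> omega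
  · rw [rk_eq_zero_of_le t (by omega)]
    omega

/-- The one-sided reduction is applied to `t` for the rows and to `t⁻¹` for the columns. -/
theorem rk_le_of_even {n : ℕ} {t u : Perm (Fin (n * 2))} (ht : t ∈ biReduced n)
    (h : ∀ p q, blk t p q ≤ blk u p q) (x y : ℕ) : rk t x y ≤ rk u x y := by
  refine rk_le_of_even_left ht (fun q => ?_) x
  have key : rk t⁻¹ y (2 * q) ≤ rk u⁻¹ y (2 * q) := by
    refine rk_le_of_even_left (inv_mem_biReduced ht) (fun p => ?_) y
    have h1 := h p q
    have h2 := rk_add_min t (2 * q) (2 * p)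
    have h3 := rk_add_min u (2 * q) (2 * p)
    rw [ck_eq_rk_inv] at h2 h3
    unfold blk at h1
    omega
  have h2 := rk_add_min t (2 * q) y
  have h3 := rk_add_min u (2 * q) y
  rw [ck_eq_rk_inv] at h2 h3
  omega

theorem blk_swap {n : ℕ} (u : Perm (Fin (n * 2))) {p q : ℕ} (hp : p ≤ n) (hq : q ≤ n) :
    blk u p q + 2 * q = blk u⁻¹ q p + 2 * p := by
  have := rk_add_min u (2 * q) (2 * p)
  rw [ck_eq_rk_inv] at this
  unfold blk
  omega

theorem blk_self_inv {n : ℕ} (u : Perm (Fin (n * 2))) (q : ℕ) : blk u⁻¹ q q = blk u q q := by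
  have := rk_add_min u (2 * q) (2 * q)
  rw [ck_eq_rk_inv] at this
  unfold blk
  omega

theorem BruhatLE.blk_le {n : ℕ} {t u : Perm (Fin (n * 2))} (h : BruhatLE t u) (p q : ℕ) :
    blk t p q ≤ blk u p q :=
  h.rk_le _ _

/-- The comparison of a bi-reduced element with any element in terms of block ranks. -/
theorem bruhatLE_of_blk_le {n : ℕ} {t u : Perm (Fin (n * 2))} (ht : t ∈ biReduced n)
    (h : ∀ p q, p ≤ q → q < n → blk t p q ≤ blk u p q)
    (h' : ∀ p q, p ≤ q → q < n → blk t⁻¹ p q ≤ blk u⁻¹ p q) : BruhatLE t u := by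
  refine bruhatLE_iff_rk_le.2 (rk_le_of_even ht fun p q => ?_)
  by_cases hq : n ≤ q
  · rw [blk, rk_eq_zero_of_le t (by omega)]
    omega
  by_cases hp : n ≤ p
  · have h1 := rk_add_min t (2 * q) (2 * p)
    have h2 := rk_add_min u (2 * q) (2 * p)
    rw [ck_eq_zero_of_le _ _ (by omega)] at h1 h2
    unfold blk
    omega
  rcases le_total p q with hpq | hpq
  · exact h p q hpq (by omega)
  · have h1 := blk_swap t (p := p) (q := q) (by omega) (by omega)
    have h2 := blk_swap u (p := p) (q := q) (by omega) (by omega)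
    have := h' q p hpq (by omega)
    omega

theorem eq_of_blk_eq {n : ℕ} {t u : Perm (Fin (n * 2))} (ht : t ∈ biReduced n)
    (hu : u ∈ biReduced n) (h : ∀ p q, p ≤ q → q < n → blk t p q = blk u p q)
    (h' : ∀ p q, p ≤ q → q < n → blk t⁻¹ p q = blk u⁻¹ p q) : t = u :=
  (bruhatLE_of_blk_le ht (fun p q hp hq => (h p q hp hq).le) fun p q hp hq =>
    (h' p q hp hq).le).antisymm (bruhatLE_of_blk_le hu (fun p q hp hq => (h p q hp hq).ge)
      fun p q hp hq => (h' p q hp hq).ge)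

/-! ### Inversions and reduced words -/

/-- The number of inversions. -/
def invNum {m : ℕ} (u : Perm (Fin m)) : ℕ := ∑ i : Fin m, rk u (i + 1) (u i)

theorem invNum_inv {m : ℕ} (u : Perm (Fin m)) : invNum u⁻¹ = invNum u := by
  have : invNum u = ∑ i : Fin m, ∑ k : Fin m, if i < k ∧ u k < u i then 1 else 0 := rfl
  rw [this, sum_comm]
  have : invNum u⁻¹ = ∑ i : Fin m, ∑ k : Fin m, if i < k ∧ u⁻¹ k < u⁻¹ i then 1 else 0 := rfl
  rw [this, ← Equiv.sum_comp u]
  refine sum_congr rfl fun i _ => ?_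
  rw [← Equiv.sum_comp u]
  refine sum_congr rfl fun k _ => ?_
  rw [inv_apply_apply, inv_apply_apply]
  exact if_congr and_comm rfl rfl

theorem invNum_one (m : ℕ) : invNum (1 : Perm (Fin m)) = 0 := by
  refine sum_eq_zero fun i _ => sum_eq_zero fun k _ => if_neg ?_
  simp only [Perm.coe_one, id]
  omega

theorem invNum_mul_simpleRefl {m k : ℕ} (u : Perm (Fin m)) (h1 : 1 ≤ k) (h2 : k < m)
    (h : val u (k - 1) < val u k) : invNum (u * simpleRefl m k) = invNum u + 1 := by
  let a : Fin m := ⟨k - 1, by omega⟩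
  let b : Fin m := ⟨k, h2⟩
  have ha : (a : ℕ) = k - 1 := rfl
  have hb : (b : ℕ) = k := rfl
  have hab : a < b := by rw [Fin.lt_def]; omega
  have hu : u a < u b := by rw [Fin.lt_def, ← val_fin, ← val_fin]; exact h
  have hs : simpleRefl m k = swap a b := by rw [simpleRefl, dif_pos ⟨h1, h2⟩]
  rw [hs]
  have key := sum_mul_swap u hab.ne fun i c => rk (u * swap a b) (i + 1) c
  simp only [rk_mul_swap u hab hu] at key
  have e1 := rk_succ u b (u a)
  have e2 := rk_succ u b (u b)
  have e3 : (∑ i : Fin m, (rk u (i + 1) (u i) + if (a : ℕ) < i + 1 ∧ (i : ℕ) + 1 ≤ b ∧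
      (u a : ℕ) < u i ∧ (u i : ℕ) ≤ u b then 1 else 0)) = invNum u := by
    refine sum_congr rfl fun i _ => ?_
    rw [if_neg, add_zero]
    rintro ⟨c1, c2, c3, -⟩
    have : i = a := Fin.ext (by omega)
    subst this
    omega
  have e4 : (∑ i : Fin m, (rk u (i + 1) ((u * swap a b) i) + if (a : ℕ) < i + 1 ∧
      (i : ℕ) + 1 ≤ b ∧ (u a : ℕ) < (u * swap a b) i ∧ ((u * swap a b) i : ℕ) ≤ u b
      then 1 else 0)) = invNum (u * swap a b) :=
    sum_congr rfl fun i _ => by rw [rk_mul_swap u hab hu]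
  rw [e3, e4] at key
  have hab' : (a : ℕ) + 1 = b := by omega
  have hu' : (u a : ℕ) < u b := hu
  rw [hab'] at key
  simp only [hu', hu'.le, le_refl, lt_irrefl, and_true, and_false, if_true, if_false,
    show ¬ ((b : ℕ) + 1 ≤ b) by omega, show (a : ℕ) < b by omega, not_lt.2 hu'.le] at key e1 e2
  omega

theorem simpleRefl_mul_self (m k : ℕ) : simpleRefl m k * simpleRefl m k = 1 := by
  unfold simpleRefl
  split_ifs <;> simp

theorem simpleRefl_inv (m k : ℕ) : (simpleRefl m k)⁻¹ = simpleRefl m k :=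
  inv_eq_of_mul_eq_one_left (simpleRefl_mul_self m k)

theorem invNum_mul_simpleRefl_le {m k : ℕ} (u : Perm (Fin m)) (h1 : 1 ≤ k) (h2 : k < m) :
    invNum (u * simpleRefl m k) ≤ invNum u + 1 := by
  rcases lt_trichotomy (val u (k - 1)) (val u k) with h | h | h
  · exact (invNum_mul_simpleRefl u h1 h2 h).le
  · have := val_injective u h
    omega
  · have := invNum_mul_simpleRefl (u * simpleRefl m k) h1 h2 (by
      rw [val_mul, val_mul, val_simpleRefl h1 h2, val_simpleRefl h1 h2]
      simpa [show k ≠ k - 1 by omega] using h)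
    rw [mul_assoc, simpleRefl_mul_self, mul_one] at this
    omega

theorem invNum_wordProd_le {m : ℕ} (v : List ℕ) (hv : IsWord m v) :
    invNum (wordProd m v) ≤ v.length := by
  induction v using List.reverseRecOn with
  | nil => simp [wordProd, invNum_one]
  | append_singleton v k ih =>
    have hk := hv k (by simp)
    have := ih fun k hk => hv k (by simp [hk])
    have h := invNum_mul_simpleRefl_le (wordProd m v) hk.1 hk.2
    have e : wordProd m (v ++ [k]) = wordProd m v * simpleRefl m k := by simp [wordProd]
    rw [e, List.length_append, List.length_singleton]
    omega

/-- Each letter creates at most one inversion, so the number of inversions bounds the length of any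
word for the element from below. -/
theorem isReducedWord_of_invNum {m : ℕ} {v : List ℕ} (hv : IsWord m v)
    (h : invNum (wordProd m v) = v.length) : IsReducedWord m v :=
  ⟨hv, fun v' hv' e => h ▸ e ▸ invNum_wordProd_le v' hv'⟩

/-! ### Doubled permutations and permutations fixing a tail -/

theorem val_doublePerm {n : ℕ} (w : Perm (Fin n)) (x : ℕ) :
    val (doublePerm w) x = 2 * val w (x / 2) + x % 2 := by
  by_cases hx : x < n * 2
  · have e : x = blockPt (⟨x / 2, by omega⟩ : Fin n) ⟨x % 2, by omega⟩ := by
      rw [blockPt_val]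
      exact (Nat.div_add_mod x 2).symm
    conv_lhs => rw [e]
    rw [val_fin, doublePerm_blockPt, blockPt_val, ← val_fin]
  · rw [val_of_le _ (by omega), val_of_le _ (by omega)]
    exact (Nat.div_add_mod x 2).symm

theorem doublePerm_one (n : ℕ) : doublePerm (1 : Perm (Fin n)) = 1 :=
  ext_val fun x => by rw [val_doublePerm, val_one, val_one, Nat.div_add_mod]

theorem doublePerm_mul {n : ℕ} (v w : Perm (Fin n)) :
    doublePerm (v * w) = doublePerm v * doublePerm w :=
  ext_val fun x => by
    rw [val_mul, val_doublePerm, val_doublePerm w, val_doublePerm v, val_mul,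
      show (2 * val w (x / 2) + x % 2) / 2 = val w (x / 2) by omega]
    omega

theorem val_doublePerm_simpleRefl {n K : ℕ} (hK : K + 1 < n) (x : ℕ) :
    val (doublePerm (simpleRefl n (K + 1))) x =
      if x = 2 * K then 2 * K + 2 else if x = 2 * K + 1 then 2 * K + 3 else
      if x = 2 * K + 2 then 2 * K else if x = 2 * K + 3 then 2 * K + 1 else x := by
  rw [val_doublePerm, val_simpleRefl (by omega) hK]
  split_ifs <;> omega

theorem doublePerm_simpleRefl {n k : ℕ} (hk : 1 ≤ k) (hkn : k < n) :
    doublePerm (simpleRefl n k) = wordProd (n * 2) [2 * k, 2 * k - 1, 2 * k + 1, 2 * k] := by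
  obtain ⟨K, rfl⟩ : ∃ K, k = K + 1 := ⟨k - 1, by omega⟩
  rw [show 2 * (K + 1) - 1 = 2 * K + 1 by omega, show 2 * (K + 1) + 1 = 2 * K + 3 by ring,
    show 2 * (K + 1) = 2 * K + 2 by ring]
  have s1 := @val_simpleRefl (n * 2) (2 * K + 1) (by omega) (by omega)
  have s2 := @val_simpleRefl (n * 2) (2 * K + 2) (by omega) (by omega)
  have s3 := @val_simpleRefl (n * 2) (2 * K + 3) (by omega) (by omega)
  rw [show 2 * K + 1 - 1 = 2 * K by omega] at s1
  rw [show 2 * K + 2 - 1 = 2 * K + 1 by omega] at s2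
  rw [show 2 * K + 3 - 1 = 2 * K + 2 by omega] at s3
  refine ext_val fun x => ?_
  rw [val_doublePerm_simpleRefl hkn]
  simp only [wordProd, List.map, List.prod_cons, List.prod_nil, mul_one, val_mul]
  by_cases h0 : x = 2 * K
  · simp [h0, s1, s2, s3]
  by_cases h1 : x = 2 * K + 1
  · simp [h1, s1, s2, s3]
  by_cases h2 : x = 2 * K + 2
  · simp [h2, s1, s2, s3]
  by_cases h3 : x = 2 * K + 3
  · simp [h3, s1, s2, s3]
  simp [h0, h1, h2, h3, s1, s2, s3]

theorem doublePerm_simpleRefl_mul_self (n k : ℕ) :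
    doublePerm (simpleRefl n k) * doublePerm (simpleRefl n k) = 1 := by
  rw [← doublePerm_mul, simpleRefl_mul_self, doublePerm_one]

theorem doublePerm_simpleRefl_inv (n k : ℕ) :
    (doublePerm (simpleRefl n k))⁻¹ = doublePerm (simpleRefl n k) :=
  inv_eq_of_mul_eq_one_left (doublePerm_simpleRefl_mul_self n k)

/-- The permutation fixes all points from `c` on. -/
def FixesFrom {m : ℕ} (u : Perm (Fin m)) (c : ℕ) : Prop := ∀ x, c ≤ x → val u x = x

theorem FixesFrom.inv {m : ℕ} {u : Perm (Fin m)} {c : ℕ} (h : FixesFrom u c) :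
    FixesFrom u⁻¹ c := fun x hx => (val_inv_eq_iff u).2 (h x hx)

theorem FixesFrom.val_lt {m : ℕ} {u : Perm (Fin m)} {c : ℕ} (h : FixesFrom u c) {x : ℕ}
    (hx : x < c) : val u x < c := by
  by_contra hc
  have := val_injective u (h _ (not_lt.1 hc))
  omega

theorem FixesFrom.rk_eq_zero {m : ℕ} {u : Perm (Fin m)} {c : ℕ} (h : FixesFrom u c) {x y : ℕ}
    (hx : c ≤ x) (hy : y ≤ x) : rk u x y = 0 := by
  rw [rk_eq_sum_range]
  refine sum_eq_zero fun i _ => if_neg ?_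
  rintro ⟨h1, h2⟩
  rw [h i (by omega)] at h2
  omega

theorem rk_mul_right {m : ℕ} (v h : Perm (Fin m)) {x : ℕ} (hx : ∀ i, x ≤ val h i ↔ x ≤ i)
    (y : ℕ) : rk (v * h) x y = rk v x y := by
  rw [rk, rk, ← Equiv.sum_comp h fun i : Fin m => if x ≤ (i : ℕ) ∧ (v i : ℕ) < y then 1 else 0]
  refine sum_congr rfl fun i _ => ?_
  rw [← val_fin h]
  exact if_congr (and_congr_left fun _ => (hx i).symm) rfl rfl

theorem rk_mul_left {m : ℕ} (v h : Perm (Fin m)) {y : ℕ} (hy : ∀ i, val h i < y ↔ i < y)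
    (x : ℕ) : rk (h * v) x y = rk v x y := by
  refine sum_congr rfl fun i _ => ?_
  rw [Perm.mul_apply, ← val_fin h]
  exact if_congr (and_congr_right fun _ => hy _) rfl rfl

/-! ### The factors attached to a letter -/

/-- The kinds of factors in a product of `s_{2k}`, `s̃_k` and `s_{2k-1} s_{2k}`. -/
inductive Kind
  | absent | simple | double | cyclic

namespace Kind

/-- The factor of the given kind at the letter `k`. -/
def elt (n k : ℕ) : Kind → Perm (Fin (n * 2))
  | absent => 1
  | simple => simpleRefl (n * 2) (2 * k)
  | double => doublePerm (simpleRefl n k)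
  | cyclic => simpleRefl (n * 2) (2 * k - 1) * simpleRefl (n * 2) (2 * k)

/-- The length of the factor. -/
def len : Kind → ℕ
  | absent => 0
  | simple => 1
  | double => 4
  | cyclic => 2

/-- The number of points which the factor moves across its letter. -/
def rank : Kind → ℕ
  | absent => 0
  | simple => 1
  | double => 2
  | cyclic => 1

/-- The effect of multiplication by the factor on block ranks. -/
def act : Kind → ℕ → ℕ
  | absent, _ => 0
  | simple, x => x - 1
  | double, x => x
  | cyclic, x => min x 1

theorem act_le (κ : Kind) (x : ℕ) : κ.act x ≤ x := by
  cases κ <;> simp only [act] <;> omega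

theorem val_elt {n K : ℕ} (hK : K + 1 < n) (κ : Kind) (x : ℕ) :
    val (κ.elt n (K + 1)) x = match κ with
      | absent => x
      | simple => if x = 2 * K + 1 then 2 * K + 2 else if x = 2 * K + 2 then 2 * K + 1 else x
      | double => if x = 2 * K then 2 * K + 2 else if x = 2 * K + 1 then 2 * K + 3 else
          if x = 2 * K + 2 then 2 * K else if x = 2 * K + 3 then 2 * K + 1 else x
      | cyclic => if x = 2 * K then 2 * K + 1 else if x = 2 * K + 1 then 2 * K + 2 else
          if x = 2 * K + 2 then 2 * K else x := by
  cases κ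
  · exact val_one x
  · exact val_simpleRefl (by omega) (by omega) x
  · exact val_doublePerm_simpleRefl hK x
  · simp only [elt, val_mul]
    rw [val_simpleRefl (by omega) (by omega), val_simpleRefl (by omega) (by omega)]
    split_ifs <;> omega

theorem val_elt_inv {n K : ℕ} (hK : K + 1 < n) (κ : Kind) (x : ℕ) :
    val (κ.elt n (K + 1))⁻¹ x = match κ with
      | absent => x
      | simple => if x = 2 * K + 1 then 2 * K + 2 else if x = 2 * K + 2 then 2 * K + 1 else x
      | double => if x = 2 * K then 2 * K + 2 else if x = 2 * K + 1 then 2 * K + 3 else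
          if x = 2 * K + 2 then 2 * K else if x = 2 * K + 3 then 2 * K + 1 else x
      | cyclic => if x = 2 * K + 1 then 2 * K else if x = 2 * K + 2 then 2 * K + 1 else
          if x = 2 * K then 2 * K + 2 else x := by
  rw [val_inv_eq_iff, val_elt hK]
  cases κ <;> simp only <;> split_ifs <;> omega

theorem val_elt_zero {n K : ℕ} (hK : K + 1 < n) (κ : Kind) :
    val (κ.elt n (K + 1)) (2 * K) = match κ with
      | absent => 2 * K
      | simple => 2 * K
      | double => 2 * K + 2
      | cyclic => 2 * K + 1 := by
  rw [val_elt hK]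
  cases κ <;> simp

theorem val_elt_one {n K : ℕ} (hK : K + 1 < n) (κ : Kind) :
    val (κ.elt n (K + 1)) (2 * K + 1) = match κ with
      | absent => 2 * K + 1
      | simple => 2 * K + 2
      | double => 2 * K + 3
      | cyclic => 2 * K + 2 := by
  rw [val_elt hK]
  cases κ <;> simp

theorem val_elt_two {n K : ℕ} (hK : K + 1 < n) (κ : Kind) :
    val (κ.elt n (K + 1)) (2 * K + 2) = match κ with
      | absent => 2 * K + 2
      | simple => 2 * K + 1
      | double => 2 * K
      | cyclic => 2 * K := by
  rw [val_elt hK]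
  cases κ <;> simp

theorem val_elt_three {n K : ℕ} (hK : K + 1 < n) (κ : Kind) :
    val (κ.elt n (K + 1)) (2 * K + 3) = match κ with
      | absent => 2 * K + 3
      | simple => 2 * K + 3
      | double => 2 * K + 1
      | cyclic => 2 * K + 3 := by
  rw [val_elt hK]
  cases κ <;> simp

theorem val_elt_of_lt_or_lt {n K : ℕ} (hK : K + 1 < n) (κ : Kind) {x : ℕ}
    (hx : x < 2 * K ∨ 2 * K + 3 < x) : val (κ.elt n (K + 1)) x = x := by
  rw [val_elt hK]
  cases κ
  · rfl
  all_goals simp only; split_ifs <;> omega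

theorem le_val_elt_iff {n K : ℕ} (hK : K + 1 < n) (κ : Kind) {x : ℕ} (hx : x ≤ 2 * K) (i : ℕ) :
    x ≤ val (κ.elt n (K + 1)) i ↔ x ≤ i := by
  rw [val_elt hK]
  cases κ <;> simp only <;> split_ifs <;> omega

theorem val_elt_inv_lt_iff {n K : ℕ} (hK : K + 1 < n) (κ : Kind) {y : ℕ} (hy : y ≤ 2 * K) (i : ℕ) :
    val (κ.elt n (K + 1))⁻¹ i < y ↔ i < y := by
  rw [val_elt_inv hK]
  cases κ <;> simp only <;> split_ifs <;> omega

end Kind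

/-! ### Multiplication by the factor at the next letter -/

section Step

variable {n K : ℕ} {v : Perm (Fin (n * 2))}

/-- Beyond block `q` all points are fixed and have values at least `2p`, so only the two points of
block `q` can contribute. -/
theorem blk_two_terms {u : Perm (Fin (n * 2))} {q : ℕ} (hq : q < n) (hu : FixesFrom u (2 * q + 2))
    {p : ℕ} (hp : p ≤ q + 1) : blk u p q =
      (if val u (2 * q) < 2 * p then 1 else 0) + if val u (2 * q + 1) < 2 * p then 1 else 0 := by
  rw [blk, rk_succ_nat u (by omega), rk_succ_nat u (by omega), hu.rk_eq_zero le_rfl (by omega)]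
  omega

theorem fixesFrom_mul_elt (hK : K + 1 < n) (hv : FixesFrom v (2 * K + 2)) (κ : Kind) :
    FixesFrom (v * κ.elt n (K + 1)) (2 * K + 4) := by
  intro x hx
  rw [val_mul, Kind.val_elt_of_lt_or_lt hK _ (by omega), hv _ (by omega)]

/-- Only the cyclic factor is delicate: it would break monotonicity of the inverse if `v` mapped the
whole block `K` onto a single block. A block rank equal to 1 excludes this, since it puts the two
images on different sides of a block boundary. -/
theorem mul_elt_mem_biReduced (hK : K + 1 < n) (hb : v ∈ biReduced n)
    (hv : FixesFrom v (2 * K + 2)) (κ : Kind)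
    (hκ : κ = .cyclic → ∃ p ≤ K, blk v p K = 1) : v * κ.elt n (K + 1) ∈ biReduced n := by
  rw [mem_biReduced_iff] at hb ⊢
  intro r hr
  rw [mul_inv_rev]
  simp only [val_mul]
  have h0 := hb K (by omega)
  have h1 : val v (2 * K + 1) < 2 * K + 2 := hv.val_lt (by omega)
  have h2 := hv (2 * K + 2) le_rfl
  have h3 := hv (2 * K + 3) (by omega)
  have h4 := hv.inv (2 * K + 2) le_rfl
  have h5 := hv.inv (2 * K + 3) (by omega)
  have hbr := hb r hr
  constructor
  · rcases (by omega : r = K ∨ r = K + 1 ∨ (2 * r + 1 < 2 * K ∨ 2 * K + 3 < 2 * r)) with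
      rfl | rfl | hrK
    · rw [Kind.val_elt_zero hK, Kind.val_elt_one hK]
      cases κ <;> simp only <;> omega
    · rw [show 2 * (K + 1) = 2 * K + 2 by ring, show 2 * K + 2 + 1 = 2 * K + 3 by ring,
        Kind.val_elt_two hK, Kind.val_elt_three hK]
      cases κ <;> simp only <;> omega
    · rw [Kind.val_elt_of_lt_or_lt hK _ (by omega), Kind.val_elt_of_lt_or_lt hK _ (by omega)]
      exact hbr.1
  · rw [Kind.val_elt_inv hK, Kind.val_elt_inv hK]
    rcases (by omega : r = K + 1 ∨ r ≤ K ∨ K + 2 ≤ r) with rfl | hrK | hrK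
    · rw [show 2 * (K + 1) = 2 * K + 2 by ring] at *
      rw [h4, h5]
      cases κ <;> simp
    · have h6 : val v⁻¹ (2 * r + 1) < 2 * K + 2 := hv.inv.val_lt (by omega)
      cases κ
      · exact hbr.2
      · simp only; split_ifs <;> omega
      · simp only; split_ifs <;> omega
      · obtain ⟨p, hp, e⟩ := hκ rfl
        rw [blk_two_terms (by omega) hv (by omega)] at e
        have h7 : ¬ (val v⁻¹ (2 * r) = 2 * K ∧ val v⁻¹ (2 * r + 1) = 2 * K + 1) := by
          rintro ⟨e1, e2⟩
          rw [val_inv_eq_iff] at e1 e2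
          split_ifs at e <;> omega
        simp only; split_ifs <;> omega
    · rw [hv.inv _ (by omega), hv.inv _ (by omega)]
      cases κ
      · simp
      all_goals simp only; split_ifs <;> omega

theorem blk_mul_elt_of_le (hK : K + 1 < n) (κ : Kind) (p : ℕ) {q : ℕ} (hq : q ≤ K) :
    blk (v * κ.elt n (K + 1)) p q = blk v p q :=
  rk_mul_right _ _ (κ.le_val_elt_iff hK (by omega)) _

theorem blk_mul_elt_inv_of_le (hK : K + 1 < n) (κ : Kind) {p : ℕ} (hp : p ≤ K) (q : ℕ) :
    blk (v * κ.elt n (K + 1))⁻¹ p q = blk v⁻¹ p q := by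
  rw [mul_inv_rev]
  exact rk_mul_left _ _ (κ.val_elt_inv_lt_iff hK (by omega)) _

/-- As `v` is increasing on block `K`, its rank there is 0, 1 or 2 according to how many of the two
images, in increasing order, are small. The simple factor passes on the larger image, the cyclic one
the smaller, the double one both, and the absent one neither. -/
theorem blk_mul_elt (hK : K + 1 < n) (hb : v ∈ biReduced n) (hv : FixesFrom v (2 * K + 2))
    (κ : Kind) {p : ℕ} (hp : p ≤ K) :
    blk (v * κ.elt n (K + 1)) p (K + 1) = κ.act (blk v p K) := by
  rw [blk_two_terms hK (fixesFrom_mul_elt hK hv κ) (by omega), blk_two_terms (by omega) hv (by omega),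
    val_mul, val_mul, show 2 * (K + 1) = 2 * K + 2 by ring, show 2 * K + 2 + 1 = 2 * K + 3 by ring,
    Kind.val_elt_two hK, Kind.val_elt_three hK]
  have h0 := ((mem_biReduced_iff.1 hb) K (by omega)).1
  have h2 := hv (2 * K + 2) le_rfl
  have h3 := hv (2 * K + 3) (by omega)
  cases κ <;> simp only [Kind.act, h2, h3] <;> split_ifs <;> omega

theorem blk_mul_elt_self (hK : K + 1 < n) (hv : FixesFrom v (2 * K + 2)) (κ : Kind) :
    blk (v * κ.elt n (K + 1)) (K + 1) (K + 1) = κ.rank := by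
  rw [blk_two_terms hK (fixesFrom_mul_elt hK hv κ) (by omega),
    val_mul, val_mul, show 2 * (K + 1) = 2 * K + 2 by ring, show 2 * K + 2 + 1 = 2 * K + 3 by ring,
    Kind.val_elt_two hK, Kind.val_elt_three hK]
  have h0 : val v (2 * K) < 2 * K + 2 := hv.val_lt (by omega)
  have h1 : val v (2 * K + 1) < 2 * K + 2 := hv.val_lt (by omega)
  have h2 := hv (2 * K + 2) le_rfl
  have h3 := hv (2 * K + 3) (by omega)
  cases κ <;> simp [Kind.rank, h0, h1, h2, h3]

/-- Along the word of the factor, each simple reflection exchanges two values in increasing order: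
the points from `2K + 2` on are fixed by `v`, hence larger than the images of block `K`. -/
theorem invNum_mul_elt (hK : K + 1 < n) (hb : v ∈ biReduced n) (hv : FixesFrom v (2 * K + 2))
    (κ : Kind) : invNum (v * κ.elt n (K + 1)) = invNum v + κ.len := by
  have h0 := ((mem_biReduced_iff.1 hb) K (by omega)).1
  have h1 : val v (2 * K + 1) < 2 * K + 2 := hv.val_lt (by omega)
  have h2 := hv (2 * K + 2) le_rfl
  have h3 := hv (2 * K + 3) (by omega)
  have hs : ∀ k, 1 ≤ k → k < n * 2 → ∀ x, val (simpleRefl (n * 2) k) x =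
    if x = k - 1 then k else if x = k then k - 1 else x := fun k h h' => val_simpleRefl h h'
  cases κ
  · simp [Kind.elt, Kind.len]
  · rw [Kind.elt, invNum_mul_simpleRefl _ (by omega) (by omega), Kind.len]
    rw [show 2 * (K + 1) - 1 = 2 * K + 1 by omega, show 2 * (K + 1) = 2 * K + 2 by ring]
    omega
  · rw [Kind.elt, doublePerm_simpleRefl (by omega) hK, Kind.len]
    simp only [wordProd, List.map, List.prod_cons, List.prod_nil, mul_one]
    rw [← mul_assoc, ← mul_assoc, ← mul_assoc, show 2 * (K + 1) - 1 = 2 * K + 1 by omega,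
      show 2 * (K + 1) + 1 = 2 * K + 3 by ring, show 2 * (K + 1) = 2 * K + 2 by ring]
    have s0 := hs (2 * K + 1) (by omega) (by omega)
    have s1 := hs (2 * K + 2) (by omega) (by omega)
    have s2 := hs (2 * K + 3) (by omega) (by omega)
    rw [invNum_mul_simpleRefl _ (by omega) (by omega), invNum_mul_simpleRefl _ (by omega) (by omega),
      invNum_mul_simpleRefl _ (by omega) (by omega), invNum_mul_simpleRefl _ (by omega) (by omega)]
    all_goals simp [val_mul, s0, s1, s2, h2, h3]
    all_goals omega
  · rw [Kind.elt, ← mul_assoc, Kind.len]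
    rw [show 2 * (K + 1) - 1 = 2 * K + 1 by omega, show 2 * (K + 1) = 2 * K + 2 by ring]
    have s0 := hs (2 * K + 1) (by omega) (by omega)
    rw [invNum_mul_simpleRefl _ (by omega) (by omega), invNum_mul_simpleRefl _ (by omega) (by omega)]
    all_goals simp [val_mul, s0, h2]
    all_goals omega

end Step

/-! ### Products assembled by increasing letters -/

section Build

variable (n : ℕ) (κ : ℕ → Kind) (dir : ℕ → Bool)

/-- The product of the factors of kinds `κ 1, …, κ k`, where the factor at the letter `r` is
multiplied on the right if `dir r`, and its inverse is multiplied on the left otherwise. -/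
def build : ℕ → Perm (Fin (n * 2))
  | 0 => 1
  | k + 1 => if dir (k + 1) then build k * (κ (k + 1)).elt n (k + 1)
      else ((κ (k + 1)).elt n (k + 1))⁻¹ * build k

/-- The block ranks of `build` (for `σ = true`) and of its inverse (for `σ = false`). -/
def chainRank (σ : Bool) (p : ℕ) : ℕ → ℕ
  | 0 => 0
  | q + 1 => if p = q + 1 then (κ (q + 1)).rank else
      if dir (q + 1) = σ then (κ (q + 1)).act (chainRank σ p q) else 0

/-- The condition on cyclic factors which makes `build` bi-reduced. -/
def Admissible : Prop :=
  ∀ k, κ (k + 1) = .cyclic → ∃ p ≤ k, chainRank κ dir (dir (k + 1)) p k = 1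

variable {κ dir}

theorem chainRank_self (σ : Bool) {q : ℕ} (hq : 1 ≤ q) : chainRank κ dir σ q q = (κ q).rank := by
  obtain ⟨q, rfl⟩ : ∃ k, q = k + 1 := ⟨q - 1, by omega⟩
  simp [chainRank]

theorem chainRank_succ (σ : Bool) {p q : ℕ} (h : p ≤ q) (hd : dir (q + 1) = σ) :
    chainRank κ dir σ p (q + 1) = (κ (q + 1)).act (chainRank κ dir σ p q) := by
  rw [chainRank, if_neg (by omega), if_pos hd]

theorem chainRank_succ_of_ne (σ : Bool) {p q : ℕ} (h : p ≤ q) (hd : dir (q + 1) ≠ σ) :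
    chainRank κ dir σ p (q + 1) = 0 := by
  rw [chainRank, if_neg (by omega), if_neg hd]

/-- Among all kinds, the double factor has the largest rank and the largest action, and an absent
factor contributes nothing. -/
theorem chainRank_mono {κ' : ℕ → Kind} (h : ∀ k, κ k = .absent ∨ κ' k = .double) (σ : Bool)
    (p q : ℕ) : chainRank κ dir σ p q ≤ chainRank κ' dir σ p q := by
  induction q with
  | zero => rfl
  | succ q ih =>
    rw [chainRank, chainRank]
    split_ifs
    · rcases h (q + 1) with h | h <;> rw [h]
      · exact Nat.zero_le _
      · cases κ (q + 1) <;> simp [Kind.rank]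
    · rcases h (q + 1) with h | h <;> rw [h]
      · exact Nat.zero_le _
      · exact (Kind.act_le _ _).trans ih
    · rfl

/-- A chain of double factors does not change the rank. -/
theorem chainRank_eq_rank_of_double {σ : Bool} {a q : ℕ} (ha : 1 ≤ a) (haq : a ≤ q)
    (h : ∀ r, a < r → r ≤ q → κ r = .double ∧ dir r = σ) :
    chainRank κ dir σ a q = (κ a).rank := by
  induction q, haq using Nat.le_induction with
  | base => exact chainRank_self σ ha
  | succ q hq ih =>
    rw [chainRank_succ σ hq (h _ (by omega) le_rfl).2, (h _ (by omega) le_rfl).1,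
      ih fun r h1 h2 => h r h1 (by omega)]
    rfl

variable (κ dir) in
/-- The properties of `build` which are preserved by multiplication with a factor. -/
structure BuildSpec (v : Perm (Fin (n * 2))) (σ : Bool) (k : ℕ) : Prop where
  mem : v ∈ biReduced n
  fixes : FixesFrom v (2 * k + 2)
  blk_eq : ∀ p q, p ≤ q → q ≤ k → blk v p q = chainRank κ dir σ p q
  blk_inv_eq : ∀ p q, p ≤ q → q ≤ k → blk v⁻¹ p q = chainRank κ dir (!σ) p q
  invNum_eq : invNum v = ∑ r ∈ range k, (κ (r + 1)).len

variable {n}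

/-- Inversion exchanges left and right multiplication, so that only right multiplication has to be
analyzed. -/
theorem BuildSpec.inv {v : Perm (Fin (n * 2))} {σ : Bool} {k : ℕ} (h : BuildSpec n κ dir v σ k) :
    BuildSpec n κ dir v⁻¹ (!σ) k where
  mem := inv_mem_biReduced h.mem
  fixes := h.fixes.inv
  blk_eq := h.blk_inv_eq
  blk_inv_eq := by simpa using h.blk_eq
  invNum_eq := (invNum_inv v).trans h.invNum_eq

theorem BuildSpec.mul_elt {v : Perm (Fin (n * 2))} {σ : Bool} {k : ℕ}
    (h : BuildSpec n κ dir v σ k) (hk : k + 1 < n) (hd : dir (k + 1) = σ)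
    (hκ : κ (k + 1) = .cyclic → ∃ p ≤ k, chainRank κ dir σ p k = 1) :
    BuildSpec n κ dir (v * (κ (k + 1)).elt n (k + 1)) σ (k + 1) where
  mem := mul_elt_mem_biReduced hk h.mem h.fixes _ fun e => by
    obtain ⟨p, hp, hp'⟩ := hκ e
    exact ⟨p, hp, by rw [h.blk_eq p k hp le_rfl, hp']⟩
  fixes := fixesFrom_mul_elt hk h.fixes _
  blk_eq p q hpq hq := by
    rcases (by omega : q ≤ k ∨ (q = k + 1 ∧ p = q) ∨ (q = k + 1 ∧ p ≤ k)) with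
      hq | ⟨rfl, rfl⟩ | ⟨rfl, hp⟩
    · rw [blk_mul_elt_of_le hk _ _ hq, h.blk_eq p q hpq hq]
    · rw [blk_mul_elt_self hk h.fixes, chainRank_self σ (by omega)]
    · rw [blk_mul_elt hk h.mem h.fixes _ hp, chainRank_succ σ hp hd, h.blk_eq p k hp le_rfl]
  blk_inv_eq p q hpq hq := by
    rcases (by omega : q ≤ k ∨ (q = k + 1 ∧ p = q) ∨ (q = k + 1 ∧ p ≤ k)) with
      hq | ⟨rfl, rfl⟩ | ⟨rfl, hp⟩
    · rw [blk_mul_elt_inv_of_le hk _ (by omega), h.blk_inv_eq p q hpq hq]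
    · rw [blk_self_inv, blk_mul_elt_self hk h.fixes, chainRank_self _ (by omega)]
    -- For the inverse, the new column has rank 0 because `v⁻¹` fixes all points from `2k + 2` on:
    -- this is how a change of direction ends a chain.
    · rw [blk_mul_elt_inv_of_le hk _ hp, chainRank_succ_of_ne _ hp (by simp [hd]), blk,
        h.fixes.inv.rk_eq_zero (by omega) (by omega)]
  invNum_eq := by rw [invNum_mul_elt hk h.mem h.fixes, h.invNum_eq, sum_range_succ]

theorem one_mem_biReduced (n : ℕ) : (1 : Perm (Fin (n * 2))) ∈ biReduced n := by
  rw [mem_biReduced_iff]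
  intro r _
  simp [val_one]

theorem buildSpec_build (h : Admissible κ dir) {k : ℕ} (hk : k ≤ n - 1) :
    BuildSpec n κ dir (build n κ dir k) true k := by
  induction k with
  | zero =>
    have h1 : FixesFrom (1 : Perm (Fin (n * 2))) 0 := fun x _ => val_one x
    refine ⟨one_mem_biReduced n, fun x _ => val_one x, fun p q hp hq => ?_, fun p q hp hq => ?_, ?_⟩
    · obtain rfl : q = 0 := by omega
      exact h1.rk_eq_zero (by omega) (by omega)
    · obtain rfl : q = 0 := by omega
      exact h1.inv.rk_eq_zero (by omega) (by omega)
    · exact invNum_one _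
  | succ k ih =>
    have ih := ih (by omega)
    have hadm := h k
    rw [build]
    split_ifs with hd
    · rw [hd] at hadm
      exact ih.mul_elt (by omega) hd hadm
    · rw [Bool.not_eq_true] at hd
      rw [hd] at hadm
      have := (ih.inv.mul_elt (by omega) hd hadm).inv
      rwa [mul_inv_rev, inv_inv] at this

end Build

/-! ### Neighbors in terms of letters and their relative positions -/

section Neighbors

variable {l : ℕ} (j : Fin l → ℕ)

/-- The right (for `σ = true`) and left (for `σ = false`) neighbor relation. -/
def IsNeighbor (σ : Bool) (A B : Set (Fin l)) (i i' : Fin l) : Prop :=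
  if σ then IsRightNeighbor j A B i i' else IsLeftNeighbor j A B i i'

open Classical in
/-- Whether the letter `k` does not stand to the left of the letter `k - 1`. -/
noncomputable def dirOf (k : ℕ) : Bool :=
  !decide (∃ i i', j i + 1 = k ∧ j i' = k ∧ i' < i)

variable {j}

theorem dirOf_eq_true_iff (hinj : Function.Injective j) {x y : Fin l} (h : j x + 1 = j y) : dirOf j (j y) = true ↔ x < y := by
  simp only [dirOf, Bool.not_eq_true', decide_eq_false_iff_not, not_exists, not_and, not_lt]
  constructor
  · intro h'
    refine lt_of_le_of_ne (h' x y h rfl) ?_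
    rintro rfl
    omega
  · intro hxy i i' h1 h2
    rw [hinj h2, hinj (show j i = j x by omega)]
    exact hxy.le

theorem dirOf_eq_false_iff (hinj : Function.Injective j) {x y : Fin l} (h : j x + 1 = j y) : dirOf j (j y) = false ↔ y < x := by
  rw [← Bool.not_eq_true, dirOf_eq_true_iff hinj h, not_lt]
  refine ⟨fun h' => lt_of_le_of_ne h' ?_, le_of_lt⟩
  rintro rfl
  omega

/-- The neighbor relation in terms of letters. -/
theorem isNeighbor_iff (hinj : Function.Injective j) (σ : Bool) (A B : Set (Fin l)) (i i' : Fin l) :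
    IsNeighbor j σ A B i i' ↔ i ∈ B \ A ∧ i' ∈ B \ A ∧ j i < j i' ∧
      (∀ r, j i < r → r ≤ j i' → dirOf j r = σ) ∧ (∀ r, j i ≤ r → r ≤ j i' → ∃ x, j x = r) ∧
      ∀ x, j i < j x → j x < j i' → x ∈ A := by
  constructor
  · intro h
    obtain ⟨h1, h2, t, c, ht, hc, rfl, rfl, hA, hj⟩ : i ∈ B \ A ∧ i' ∈ B \ A ∧
        ∃ (t : ℕ) (c : Fin (t + 1) → Fin l), 0 < t ∧
        (∀ s : Fin t, dirOf j (j (c s.succ)) = σ) ∧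
        c 0 = i ∧ c (Fin.last t) = i' ∧ (∀ k, k ≠ 0 → k ≠ Fin.last t → c k ∈ A) ∧
        ∀ k, j (c k) = j i + k := by
      cases σ
      · obtain ⟨h1, h2, t, c, ht, hc, rfl, rfl, hA, hj⟩ : IsLeftNeighbor j A B i i' := by
          simpa [IsNeighbor] using h
        refine ⟨h1, h2, t, c, ht, fun s => ?_, rfl, rfl, hA, hj⟩
        rw [dirOf_eq_false_iff hinj (x := c s.castSucc) (by
          rw [hj s.castSucc, hj s.succ]; simp; ring)]
        exact hc s.castSucc_lt_succ
      · obtain ⟨h1, h2, t, c, ht, hc, rfl, rfl, hA, hj⟩ : IsRightNeighbor j A B i i' := by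
          simpa [IsNeighbor] using h
        refine ⟨h1, h2, t, c, ht, fun s => ?_, rfl, rfl, hA, hj⟩
        rw [dirOf_eq_true_iff hinj (x := c s.castSucc) (by
          rw [hj s.castSucc, hj s.succ]; simp; ring)]
        exact hc s.castSucc_lt_succ
    have hlast := hj (Fin.last t)
    rw [Fin.val_last] at hlast
    refine ⟨h1, h2, by omega, fun r hr hr' => ?_, fun r hr hr' => ?_, fun x hx hx' => ?_⟩
    · have := hc ⟨r - j (c 0) - 1, by omega⟩
      rw [hj] at this
      simp only [Fin.val_succ] at this
      rwa [show j (c 0) + (r - j (c 0) - 1 + 1) = r by omega] at this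
    · refine ⟨c ⟨r - j (c 0), by omega⟩, ?_⟩
      rw [hj]
      simp only
      omega
    · have h3 : x = c ⟨j x - j (c 0), by omega⟩ := by
        apply hinj
        rw [hj]
        simp only
        omega
      rw [h3]
      apply hA
      · simp only [ne_eq, Fin.ext_iff, Fin.val_zero]
        omega
      · simp only [ne_eq, Fin.ext_iff, Fin.val_last]
        omega
  · rintro ⟨h1, h2, h3, h4, h5, h6⟩
    have h7 : ∀ s : Fin (j i' - j i + 1), ∃ x, j x = j i + s := fun s => h5 _ (by omega) (by omega)
    choose c hc using h7
    have hdir : ∀ s : Fin (j i' - j i), dirOf j (j (c s.succ)) = σ := fun s => by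
      rw [hc]
      exact h4 _ (by simp) (by simp only [Fin.val_succ]; omega)
    have hstep : ∀ s : Fin (j i' - j i), j (c s.castSucc) + 1 = j (c s.succ) := fun s => by
      rw [hc, hc]
      simp
      ring
    have c0 : c 0 = i := hinj (by rw [hc]; simp)
    have cl : c (Fin.last _) = i' := hinj (by rw [hc]; simp; omega)
    have hA : ∀ k, k ≠ 0 → k ≠ Fin.last (j i' - j i) → c k ∈ A := by
      intro k hk hk'
      simp only [ne_eq, Fin.ext_iff, Fin.val_zero, Fin.val_last] at hk hk'
      exact h6 _ (by rw [hc]; omega) (by rw [hc]; omega)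
    cases σ
    · simp only [IsNeighbor, Bool.false_eq_true, if_false]
      refine ⟨h1, h2, j i' - j i, c, by omega, Fin.strictAnti_iff_succ_lt.2 fun s => ?_, c0, cl, hA, hc⟩
      exact (dirOf_eq_false_iff hinj (hstep s)).1 (hdir s)
    · simp only [IsNeighbor, if_true]
      refine ⟨h1, h2, j i' - j i, c, by omega, Fin.strictMono_iff_lt_succ.2 fun s => ?_, c0, cl, hA, hc⟩
      exact (dirOf_eq_true_iff hinj (hstep s)).1 (hdir s)

theorem exists_isNeighbor_iff {A B : Set (Fin l)} {i : Fin l} :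
    i ∈ nbrs j A B ↔ ∃ σ i', IsNeighbor j σ A B i i' := by
  simp [nbrs, rightNbrs, leftNbrs, IsNeighbor, or_comm]

end Neighbors

/-! ### Commutation relations -/

section Commute

variable {m : ℕ}

/-- The permutation fixes all points below `c`. -/
def FixesBelow (u : Perm (Fin m)) (c : ℕ) : Prop := ∀ x, x < c → val u x = x

theorem FixesBelow.le_val {u : Perm (Fin m)} {c : ℕ} (h : FixesBelow u c) {x : ℕ} (hx : c ≤ x) :
    c ≤ val u x := by
  by_contra hc
  have := val_injective u (h _ (not_le.1 hc))
  omega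

theorem FixesFrom.mul {u v : Perm (Fin m)} {c : ℕ} (hu : FixesFrom u c) (hv : FixesFrom v c) :
    FixesFrom (u * v) c := fun x hx => by rw [val_mul, hv x hx, hu x hx]

theorem FixesBelow.mul {u v : Perm (Fin m)} {c : ℕ} (hu : FixesBelow u c) (hv : FixesBelow v c) :
    FixesBelow (u * v) c := fun x hx => by rw [val_mul, hv x hx, hu x hx]

theorem FixesFrom.commute {u v : Perm (Fin m)} {c : ℕ} (hu : FixesFrom u c)
    (hv : FixesBelow v c) : Commute u v := by
  refine ext_val fun x => ?_
  rw [val_mul, val_mul]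
  rcases lt_or_ge x c with hx | hx
  · rw [hv x hx, hv _ (hu.val_lt hx)]
  · rw [hu x hx, hu _ (hv.le_val hx)]

theorem fixesFrom_simpleRefl {k c : ℕ} (h : k < c) : FixesFrom (simpleRefl m k) c := by
  intro x hx
  by_cases hk : 1 ≤ k ∧ k < m
  · rw [val_simpleRefl hk.1 hk.2, if_neg (by omega), if_neg (by omega)]
  · rw [simpleRefl, dif_neg hk, val_one]

theorem fixesBelow_simpleRefl {k c : ℕ} (h : c < k) : FixesBelow (simpleRefl m k) c := by
  intro x hx
  by_cases hk : 1 ≤ k ∧ k < m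
  · rw [val_simpleRefl hk.1 hk.2, if_neg (by omega), if_neg (by omega)]
  · rw [simpleRefl, dif_neg hk, val_one]

theorem wordProd_cons (k : ℕ) (v : List ℕ) :
    wordProd m (k :: v) = simpleRefl m k * wordProd m v := by
  simp [wordProd]

theorem fixesFrom_wordProd {v : List ℕ} {c : ℕ} (h : ∀ k ∈ v, k < c) :
    FixesFrom (wordProd m v) c := by
  induction v with
  | nil => exact fun x _ => val_one x
  | cons k v ih =>
    rw [wordProd_cons]
    exact (fixesFrom_simpleRefl (h k (by simp))).mul (ih fun k hk => h k (by simp [hk]))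

theorem fixesBelow_wordProd {v : List ℕ} {c : ℕ} (h : ∀ k ∈ v, c < k) :
    FixesBelow (wordProd m v) c := by
  induction v with
  | nil => exact fun x _ => val_one x
  | cons k v ih =>
    rw [wordProd_cons]
    exact (fixesBelow_simpleRefl (h k (by simp))).mul (ih fun k hk => h k (by simp [hk]))

theorem wordProd_flatMap {α : Type*} (L : List α) (f : α → List ℕ) :
    wordProd m (L.flatMap f) = (L.map fun a => wordProd m (f a)).prod := by
  induction L with
  | nil => rfl
  | cons a L ih =>
    rw [List.flatMap_cons, List.map_cons, List.prod_cons, ← ih]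
    simp [wordProd]

/-- The doubled reflection exchanges two adjacent blocks, hence conjugates the transposition inside
the first block into that inside the second. This relation transports the extra reflection along a
chain of positions in `I_f`. -/
theorem simpleRefl_mul_doublePerm {n k : ℕ} (hk : k + 1 < n) :
    simpleRefl (n * 2) (2 * k + 1) * doublePerm (simpleRefl n (k + 1)) =
      doublePerm (simpleRefl n (k + 1)) * simpleRefl (n * 2) (2 * k + 3) := by
  have s1 := @val_simpleRefl (n * 2) (2 * k + 1) (by omega) (by omega)
  have s3 := @val_simpleRefl (n * 2) (2 * k + 3) (by omega) (by omega)
  rw [show 2 * k + 1 - 1 = 2 * k by omega] at s1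
  rw [show 2 * k + 3 - 1 = 2 * k + 2 by omega] at s3
  refine ext_val fun x => ?_
  rw [val_mul, val_mul, val_doublePerm_simpleRefl hk, val_doublePerm_simpleRefl hk]
  by_cases h0 : x = 2 * k
  · simp [h0, s1, s3]
  by_cases h1 : x = 2 * k + 1
  · simp [h1, s1, s3]
  by_cases h2 : x = 2 * k + 2
  · simp [h2, s1, s3]
  by_cases h3 : x = 2 * k + 3
  · simp [h3, s1, s3]
  simp [h0, h1, h2, h3, s1, s3]

theorem doublePerm_mul_simpleRefl {n k : ℕ} (hk : k + 1 < n) :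
    doublePerm (simpleRefl n (k + 1)) * simpleRefl (n * 2) (2 * k + 1) =
      simpleRefl (n * 2) (2 * k + 3) * doublePerm (simpleRefl n (k + 1)) := by
  have h := congrArg (fun g => g⁻¹) (simpleRefl_mul_doublePerm hk)
  simpa only [mul_inv_rev, doublePerm_simpleRefl_inv, simpleRefl_inv] using h

end Commute

/-! ### Inserting a factor into an ordered product -/

section ListProd

variable {M α : Type*} [Monoid M] [LinearOrder α]

/-- The inserted factor commutes with everything after it, so it slides to the right end. -/
theorem prod_map_update_eq_mul_right {L : List α} (hL : L.Pairwise (· < ·)) {a : α} (ha : a ∈ L)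
    {f : α → M} (hf : f a = 1) {x : M} (h : ∀ b, a < b → Commute (f b) x) :
    (L.map (Function.update f a x)).prod = (L.map f).prod * x := by
  induction L with
  | nil => simp at ha
  | cons b L ih =>
    rw [List.pairwise_cons] at hL
    by_cases hab : a = b
    · subst hab
      have e : L.map (Function.update f a x) = L.map f := List.map_congr_left fun c hc =>
        Function.update_of_ne (hL.1 c hc).ne' _ _
      have hc : Commute (L.map f).prod x := by
        refine Commute.list_prod_left _ _ fun y hy => ?_
        obtain ⟨c, hc, rfl⟩ := List.mem_map.1 hy
        exact h c (hL.1 c hc)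
      rw [List.map_cons, List.prod_cons, List.map_cons, List.prod_cons, e, hf, one_mul,
        Function.update_self, hc.eq]
    · have ha' : a ∈ L := by simpa [hab] using ha
      rw [List.map_cons, List.prod_cons, List.map_cons, List.prod_cons, ih hL.2 ha', mul_assoc,
        Function.update_of_ne (Ne.symm hab)]

theorem prod_map_update_eq_mul_left {L : List α} (hL : L.Pairwise (· < ·)) {a : α} (ha : a ∈ L)
    {f : α → M} (hf : f a = 1) {x : M} (h : ∀ b, b < a → Commute (f b) x) :
    (L.map (Function.update f a x)).prod = x * (L.map f).prod := by
  induction L with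
  | nil => simp at ha
  | cons b L ih =>
    rw [List.pairwise_cons] at hL
    by_cases hab : a = b
    · subst hab
      have e : L.map (Function.update f a x) = L.map f := List.map_congr_left fun c hc =>
        Function.update_of_ne (hL.1 c hc).ne' _ _
      rw [List.map_cons, List.prod_cons, List.map_cons, List.prod_cons, e, hf, one_mul,
        Function.update_self]
    · have ha' : a ∈ L := by simpa [hab] using ha
      rw [List.map_cons, List.prod_cons, List.map_cons, List.prod_cons, ih hL.2 ha',
        Function.update_of_ne (Ne.symm hab), ← mul_assoc, (h b (hL.1 a ha')).eq, mul_assoc]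

end ListProd

/-! ### From triplets to kinds of factors -/

section Triplets

variable {l : ℕ} {j : Fin l → ℕ} {Q : Triplet l}

theorem IsNeighbor.univ {σ : Bool} {A B : Set (Fin l)} {i i' : Fin l}
    (hinj : Function.Injective j) (h : IsNeighbor j σ A B i i') :
    IsNeighbor j σ A Set.univ i i' := by
  rw [isNeighbor_iff hinj] at h ⊢
  exact ⟨⟨trivial, h.1.2⟩, ⟨trivial, h.2.1.2⟩, h.2.2⟩

/-- The target is the first letter above `j i` whose position is not in `A`, and the side is already
decided by the letter `j i + 1`. -/
theorem IsNeighbor.target_unique {σ τ : Bool} {A B : Set (Fin l)} {i i₁ i₂ : Fin l}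
    (hinj : Function.Injective j) (h : IsNeighbor j σ A B i i₁) (h' : IsNeighbor j τ A B i i₂) :
    σ = τ ∧ i₁ = i₂ := by
  rw [isNeighbor_iff hinj] at h h'
  obtain ⟨-, ⟨-, a1⟩, a2, a3, -, a4⟩ := h
  obtain ⟨-, ⟨-, b1⟩, b2, b3, -, b4⟩ := h'
  refine ⟨by rw [← a3 (j i + 1) (by omega) (by omega), b3 (j i + 1) (by omega) (by omega)], ?_⟩
  rcases lt_trichotomy (j i₁) (j i₂) with h | h | h
  · exact absurd (b4 _ a2 h) a1
  · exact hinj h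
  · exact absurd (a4 _ b2 h) b1

/-- Dually, the source is the last letter below `j i'` whose position is not in `A`. Hence a cyclic
factor comes from exactly one element of `I`. -/
theorem IsNeighbor.source_unique {σ τ : Bool} {A B : Set (Fin l)} {i₁ i₂ i' : Fin l}
    (hinj : Function.Injective j) (h : IsNeighbor j σ A B i₁ i') (h' : IsNeighbor j τ A B i₂ i') :
    i₁ = i₂ := by
  rw [isNeighbor_iff hinj] at h h'
  obtain ⟨⟨-, a1⟩, -, a2, a3, -, a4⟩ := h
  obtain ⟨⟨-, b1⟩, -, b2, b3, -, b4⟩ := h'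
  rcases lt_trichotomy (j i₁) (j i₂) with h | h | h
  · exact absurd (a4 _ h b2) b1
  · exact hinj h
  · exact absurd (b4 _ h a2) a1

open Classical in
variable (j Q) in
/-- The kind of the factor at a letter in the product `build` which is equal to `𝐪 Q`. -/
noncomputable def kindOf (k : ℕ) : Kind :=
  if ∃ i ∈ Q.Ie, j i = k then
    if ∃ i ∈ Q.If, j i = k then .double
    else if ∃ σ, ∃ i ∈ Q.I, ∃ i', j i' = k ∧ IsNeighbor j σ Q.If Set.univ i i' then .cyclic
    else .simple
  else .absent

theorem kindOf_eq_absent_iff {k : ℕ} : kindOf j Q k = .absent ↔ ∀ i, j i = k → i ∉ Q.Ie := by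
  unfold kindOf
  split_ifs with h1 h2 h3
  · simpa using h1.imp fun i hi => hi.symm
  · simpa using h1.imp fun i hi => hi.symm
  · simpa using h1.imp fun i hi => hi.symm
  · push Not at h1
    simp only [true_iff]
    exact fun i hi hi' => h1 i hi' hi

theorem kindOf_of_notMem {i : Fin l} (hinj : Function.Injective j) (h : i ∉ Q.Ie) :
    kindOf j Q (j i) = .absent :=
  kindOf_eq_absent_iff.2 fun _ hk => hinj hk ▸ h

theorem kindOf_of_mem_If {i : Fin l} (hQ : Q ∈ triplets j) (h : i ∈ Q.If) :
    kindOf j Q (j i) = .double := by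
  rw [kindOf, if_pos ⟨i, hQ.1 h, rfl⟩, if_pos ⟨i, h, rfl⟩]

theorem kindOf_of_target {i i' : Fin l} {σ : Bool} (hinj : Function.Injective j) (hi' : i' ∈ Q.Ie)
    (hi : i ∈ Q.I) (h : IsNeighbor j σ Q.If Set.univ i i') : kindOf j Q (j i') = .cyclic := by
  rw [kindOf, if_pos ⟨i', hi', rfl⟩, if_neg, if_pos ⟨σ, i, hi, i', rfl, h⟩]
  rintro ⟨x, hx, e⟩
  rw [isNeighbor_iff hinj] at h
  exact h.2.1.2 (hinj e ▸ hx)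

theorem kindOf_of_not_target {i' : Fin l} (hinj : Function.Injective j) (hi' : i' ∈ Q.Ie)
    (hf : i' ∉ Q.If) (h : ∀ σ, ∀ i ∈ Q.I, ¬ IsNeighbor j σ Q.If Set.univ i i') :
    kindOf j Q (j i') = .simple := by
  rw [kindOf, if_pos ⟨i', hi', rfl⟩, if_neg, if_neg]
  · rintro ⟨σ, i, hi, x, e, hn⟩
    exact h σ i hi (hinj e ▸ hn)
  · rintro ⟨x, hx, e⟩
    exact hf (hinj e ▸ hx)

theorem rank_kindOf {i : Fin l} (hinj : Function.Injective j) (hi : i ∈ Q.Ie) (hf : i ∉ Q.If) :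
    (kindOf j Q (j i)).rank = 1 := by
  rw [kindOf, if_pos ⟨i, hi, rfl⟩, if_neg]
  · split_ifs <;> rfl
  · rintro ⟨x, hx, e⟩
    exact hf (hinj e ▸ hx)

/-- An element of `I` has a neighbor, and both are contained in `I_e`. -/
theorem exists_isNeighbor_of_mem_I (hinj : Function.Injective j) (hQ : Q ∈ triplets j) {i : Fin l}
    (hi : i ∈ Q.I) :
    i ∈ Q.Ie ∧ ∃ σ, ∃ i' ∈ Q.Ie, IsNeighbor j σ Q.If Set.univ i i' := by
  obtain ⟨σ, i', h⟩ := exists_isNeighbor_iff.1 (hQ.2 hi)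
  have h' := h
  rw [isNeighbor_iff hinj] at h'
  exact ⟨h'.1.1, σ, i', h'.2.1.1, h.univ hinj⟩

theorem target_mem_Ie (hinj : Function.Injective j) (hQ : Q ∈ triplets j) {i i' : Fin l} {σ : Bool}
    (hi : i ∈ Q.I) (h : IsNeighbor j σ Q.If Set.univ i i') : i' ∈ Q.Ie := by
  obtain ⟨-, τ, i'', h1, h2⟩ := exists_isNeighbor_of_mem_I hinj hQ hi
  rwa [(h.target_unique hinj h2).2]

/-- The block rank along a chain to a neighbor, before the last letter. -/
theorem chainRank_kindOf (hinj : Function.Injective j) (hQ : Q ∈ triplets j) {i i' : Fin l}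
    {σ : Bool} (hi1 : 1 ≤ j i) (h : IsNeighbor j σ Q.If Set.univ i i') :
    chainRank (kindOf j Q) (dirOf j) σ (j i) (j i' - 1) = (kindOf j Q (j i)).rank := by
  rw [isNeighbor_iff hinj] at h
  obtain ⟨-, -, a1, a2, a3, a4⟩ := h
  refine chainRank_eq_rank_of_double hi1 (by omega) fun r h1 h2 => ⟨?_, a2 r h1 (by omega)⟩
  obtain ⟨x, rfl⟩ := a3 r (by omega) (by omega)
  exact kindOf_of_mem_If hQ (a4 x h1 (by omega))

/-- The letter of the element of `I` that causes the cyclic factor is the required row: its factor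
has rank 1, and the double factors in between preserve this rank. -/
theorem admissible_kindOf (hinj : Function.Injective j) (hj : ∀ i, 1 ≤ j i) (hQ : Q ∈ triplets j) :
    Admissible (kindOf j Q) (dirOf j) := by
  intro k hk
  have : ∃ σ, ∃ i ∈ Q.I, ∃ i', j i' = k + 1 ∧ IsNeighbor j σ Q.If Set.univ i i' := by
    unfold kindOf at hk
    split_ifs at hk with h1 h2 h3
    exact h3
  obtain ⟨σ, i, hi, i', e, h⟩ := this
  have h' := h
  rw [isNeighbor_iff hinj] at h'
  refine ⟨j i, by omega, ?_⟩
  rw [← e, h'.2.2.2.1 _ h'.2.2.1 le_rfl]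
  have := chainRank_kindOf hinj hQ (hj i) h
  rw [e, Nat.add_sub_cancel] at this
  rw [this]
  exact rank_kindOf hinj (exists_isNeighbor_of_mem_I hinj hQ hi).1 h'.1.2

variable (j Q) in
/-- There is an element of `I` at a letter `≤ k` with a neighbor at a letter `> k`. -/
def Pending (σ : Bool) (k : ℕ) : Prop :=
  ∃ i ∈ Q.I, ∃ i', IsNeighbor j σ Q.If Set.univ i i' ∧ j i ≤ k ∧ k < j i'

theorem Pending.exists_letter {σ : Bool} {k : ℕ} (hinj : Function.Injective j)
    (hQ : Q ∈ triplets j) (h : Pending j Q σ k) :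
    dirOf j (k + 1) = σ ∧ ∃ i ∈ Q.Ie, j i = k + 1 := by
  obtain ⟨i, hi, i', h, h1, h2⟩ := h
  have hi' := target_mem_Ie hinj hQ hi h
  rw [isNeighbor_iff hinj] at h
  obtain ⟨-, -, a1, a2, a3, a4⟩ := h
  refine ⟨a2 _ (by omega) (by omega), ?_⟩
  obtain ⟨x, hx⟩ := a3 (k + 1) (by omega) (by omega)
  refine ⟨x, ?_, hx⟩
  rcases (by omega : k + 1 < j i' ∨ k + 1 = j i') with h | h
  · exact hQ.1 (a4 x (by omega) (by omega))
  · rwa [hinj (hx.trans h)]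

theorem pending_succ_of_mem_If {σ : Bool} {k : ℕ} {x : Fin l} (hinj : Function.Injective j)
    (hx : j x = k + 1) (hf : x ∈ Q.If) : Pending j Q σ (k + 1) ↔ Pending j Q σ k := by
  constructor
  · rintro ⟨i, hi, i', h, h1, h2⟩
    refine ⟨i, hi, i', h, ?_, by omega⟩
    by_contra hc
    rw [isNeighbor_iff hinj] at h
    exact h.1.2 (hinj (show j i = j x by omega) ▸ hf)
  · rintro ⟨i, hi, i', h, h1, h2⟩
    refine ⟨i, hi, i', h, by omega, ?_⟩
    by_contra hc
    rw [isNeighbor_iff hinj] at h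
    exact h.2.1.2 (hinj (show j i' = j x by omega) ▸ hf)

theorem pending_iff_of_notMem_If {σ : Bool} {k : ℕ} {x : Fin l} (hinj : Function.Injective j)
    (hx : j x = k + 1) (hf : x ∉ Q.If) :
    Pending j Q σ k ↔ ∃ i ∈ Q.I, IsNeighbor j σ Q.If Set.univ i x := by
  constructor
  · rintro ⟨i, hi, i', h, h1, h2⟩
    refine ⟨i, hi, ?_⟩
    have h' := h
    rw [isNeighbor_iff hinj] at h'
    rcases (by omega : k + 1 < j i' ∨ k + 1 = j i') with h3 | h3
    · exact absurd (h'.2.2.2.2.2 x (by omega) (by omega)) hf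
    · rwa [hinj (hx.trans h3)]
  · rintro ⟨i, hi, h⟩
    have h' := h
    rw [isNeighbor_iff hinj] at h'
    exact ⟨i, hi, x, h, by omega, by omega⟩

theorem pending_succ_iff_of_notMem_If {σ : Bool} {k : ℕ} {x : Fin l} (hinj : Function.Injective j)
    (hx : j x = k + 1) (hf : x ∉ Q.If) :
    Pending j Q σ (k + 1) ↔ x ∈ Q.I ∧ ∃ i', IsNeighbor j σ Q.If Set.univ x i' := by
  constructor
  · rintro ⟨i, hi, i', h, h1, h2⟩
    have h' := h
    rw [isNeighbor_iff hinj] at h'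
    rcases (by omega : j i < k + 1 ∨ j i = k + 1) with h3 | h3
    · exact absurd (h'.2.2.2.2.2 x (by omega) (by omega)) hf
    · obtain rfl := hinj (h3.trans hx.symm)
      exact ⟨hi, i', h⟩
  · rintro ⟨hi, i', h⟩
    have h' := h
    rw [isNeighbor_iff hinj] at h'
    exact ⟨x, hi, i', h, by omega, by omega⟩

end Triplets

/-! ### Comparison of `𝐪 Q` with the assembled product -/

section Product

variable {n l : ℕ} {j : Fin l → ℕ} {Q : Triplet l}

theorem letterBlock_of_notMem {i : Fin l} (h : i ∉ Q.Ie) : letterBlock j Q i = [] := by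
  rw [letterBlock, if_pos h]

theorem letterBlock_of_mem_If {i : Fin l} (hQ : Q ∈ triplets j) (h : i ∈ Q.If) :
    letterBlock j Q i = [2 * j i, 2 * j i - 1, 2 * j i + 1, 2 * j i] := by
  rw [letterBlock, if_neg (not_not.2 (hQ.1 h)), if_pos h]

theorem letterBlock_of_isNeighbor {i i' : Fin l} {σ : Bool} (hinj : Function.Injective j)
    (he : i ∈ Q.Ie) (hi : i ∈ Q.I) (h : IsNeighbor j σ Q.If Set.univ i i') :
    letterBlock j Q i = if σ then [2 * j i, 2 * j i + 1] else [2 * j i + 1, 2 * j i] := by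
  have h' := h
  rw [isNeighbor_iff hinj] at h'
  rw [letterBlock, if_neg (not_not.2 he), if_neg h'.1.2]
  cases σ
  · rw [if_neg, if_pos]
    · rfl
    · exact ⟨hi, i', by simpa [IsNeighbor] using h⟩
    · rintro ⟨-, i'', h2⟩
      have h3 : IsNeighbor j true Q.If Set.univ i i'' := by simpa [IsNeighbor] using h2
      simpa using (h.target_unique hinj h3).1
  · rw [if_pos]
    · rfl
    · exact ⟨hi, i', by simpa [IsNeighbor] using h⟩

theorem letterBlock_of_notMem_I {i : Fin l} (he : i ∈ Q.Ie) (hf : i ∉ Q.If) (hi : i ∉ Q.I) :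
    letterBlock j Q i = [2 * j i] := by
  rw [letterBlock, if_neg (not_not.2 he), if_neg hf, if_neg fun h => hi h.1, if_neg fun h => hi h.1]

theorem letterBlock_bounds (hj : ∀ i, 1 ≤ j i ∧ j i < n) {i : Fin l} {k : ℕ}
    (hk : k ∈ letterBlock j Q i) : 2 * j i - 1 ≤ k ∧ k ≤ 2 * j i + 1 := by
  have := hj i
  unfold letterBlock at hk
  split_ifs at hk <;> simp at hk <;> omega

theorem isWord_omegaWord (hj : ∀ i, 1 ≤ j i ∧ j i < n) : IsWord (n * 2) (omegaWord j Q) := by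
  intro k hk
  obtain ⟨i, -, hi⟩ := List.mem_flatMap.1 hk
  have := letterBlock_bounds hj hi
  have := hj i
  omega

variable (n j Q) in
/-- The product of the factors of `𝐪 Q` at the letters up to `k`. -/
noncomputable def partialProd (k : ℕ) : Perm (Fin (n * 2)) :=
  ((List.finRange l).map fun i => if j i ≤ k then wordProd (n * 2) (letterBlock j Q i) else 1).prod

variable (j Q) in
/-- The length of the factors of `ω_Q` at the letters up to `k`. -/
noncomputable def partialLength (k : ℕ) : ℕ :=
  ∑ i, if j i ≤ k then (letterBlock j Q i).length else 0

theorem partialProd_zero (hj : ∀ i, 1 ≤ j i ∧ j i < n) : partialProd n j Q 0 = 1 := by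
  refine List.prod_eq_one fun x hx => ?_
  obtain ⟨i, -, rfl⟩ := List.mem_map.1 hx
  have := hj i
  rw [if_neg (by omega)]

theorem partialLength_zero (hj : ∀ i, 1 ≤ j i ∧ j i < n) : partialLength j Q 0 = 0 :=
  sum_eq_zero fun i _ => if_neg (by have := hj i; omega)

theorem partialProd_last (hj : ∀ i, 1 ≤ j i ∧ j i < n) :
    partialProd n j Q (n - 1) = qMap j n Q := by
  rw [qMap, omegaWord, wordProd_flatMap, partialProd]
  congr 1
  refine List.map_congr_left fun i _ => if_pos ?_
  have := hj i
  omega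

theorem partialLength_last (hj : ∀ i, 1 ≤ j i ∧ j i < n) :
    partialLength j Q (n - 1) = (omegaWord j Q).length := by
  rw [omegaWord, List.length_flatMap, partialLength, ← List.sum_ofFn, List.ofFn_eq_map]
  congr 1
  refine List.map_congr_left fun i _ => if_pos ?_
  have := hj i
  omega

theorem partialProd_succ_of_forall_ne {k : ℕ} (h : ∀ i, j i ≠ k + 1) :
    partialProd n j Q (k + 1) = partialProd n j Q k := by
  unfold partialProd
  congr 1
  refine List.map_congr_left fun i _ => ?_
  have := h i
  exact if_congr (by omega) rfl rfl

theorem partialLength_succ_of_forall_ne {k : ℕ} (h : ∀ i, j i ≠ k + 1) :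
    partialLength j Q (k + 1) = partialLength j Q k := by
  refine sum_congr rfl fun i _ => ?_
  have := h i
  exact if_congr (by omega) rfl rfl

theorem update_letter_eq {M : Type*} (hinj : Function.Injective j) (g : Fin l → M) (e : M)
    {k : ℕ} {x : Fin l} (hx : j x = k + 1) :
    (fun i => if j i ≤ k + 1 then g i else e) =
      Function.update (fun i => if j i ≤ k then g i else e) x (g x) := by
  funext i
  by_cases hi : i = x
  · subst hi
    rw [Function.update_self, if_pos hx.le]
  · rw [Function.update_of_ne hi]
    have : j i ≠ j x := fun h => hi (hinj h)
    exact if_congr (by omega) rfl rfl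

theorem partialLength_succ (hinj : Function.Injective j) {k : ℕ} {x : Fin l} (hx : j x = k + 1) :
    partialLength j Q (k + 1) = partialLength j Q k + (letterBlock j Q x).length := by
  unfold partialLength
  rw [update_letter_eq hinj _ _ hx, sum_update_of_mem (mem_univ x),
    ← add_sum_erase univ _ (mem_univ x), if_neg (by omega), zero_add, sdiff_singleton_eq_erase,
    add_comm]

theorem commute_letterBlock (hj : ∀ i, 1 ≤ j i ∧ j i < n) {x y : Fin l} (h : j y + 1 < j x) :
    Commute (wordProd (n * 2) (letterBlock j Q y)) (wordProd (n * 2) (letterBlock j Q x)) := by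
  refine FixesFrom.commute (c := 2 * j y + 2) (fixesFrom_wordProd fun k hk => ?_)
    (fixesBelow_wordProd fun k hk => ?_)
  · have := letterBlock_bounds hj hk
    omega
  · have := letterBlock_bounds hj hk
    omega

/-- Among the letters up to `k`, only `k` itself may fail to commute with `k + 1`, and here it does
not stand to the right of `k + 1`. -/
theorem partialProd_succ_of_dirOf (hinj : Function.Injective j) (hj : ∀ i, 1 ≤ j i ∧ j i < n)
    {k : ℕ} {x : Fin l} (hx : j x = k + 1) (hd : dirOf j (k + 1) = true) :
    partialProd n j Q (k + 1) = partialProd n j Q k * wordProd (n * 2) (letterBlock j Q x) := by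
  unfold partialProd
  rw [update_letter_eq hinj _ _ hx]
  refine prod_map_update_eq_mul_right (List.pairwise_lt_finRange l) (List.mem_finRange x)
    (if_neg (by omega)) fun y hy => ?_
  split_ifs with hyk
  · refine commute_letterBlock hj ?_
    rcases (by omega : j y + 1 < j x ∨ j y + 1 = j x) with h | h
    · exact h
    · rw [← hx, dirOf_eq_true_iff hinj h] at hd
      exact absurd hd hy.not_gt
  · exact Commute.one_left _

theorem partialProd_succ_of_not_dirOf (hinj : Function.Injective j) (hj : ∀ i, 1 ≤ j i ∧ j i < n)
    {k : ℕ} {x : Fin l} (hx : j x = k + 1) (hd : dirOf j (k + 1) = false) :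
    partialProd n j Q (k + 1) = wordProd (n * 2) (letterBlock j Q x) * partialProd n j Q k := by
  unfold partialProd
  rw [update_letter_eq hinj _ _ hx]
  refine prod_map_update_eq_mul_left (List.pairwise_lt_finRange l) (List.mem_finRange x)
    (if_neg (by omega)) fun y hy => ?_
  split_ifs with hyk
  · refine commute_letterBlock hj ?_
    rcases (by omega : j y + 1 < j x ∨ j y + 1 = j x) with h | h
    · exact h
    · rw [← hx, dirOf_eq_false_iff hinj h] at hd
      exact absurd hd hy.not_gt
  · exact Commute.one_left _

/-- Comparison of the partial products of `𝐪 Q` with `build`. If the element of `I` at a letter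
`≤ k` has its neighbor at a letter `> k`, then its additional factor `s_{2k+1}` is not yet part
of `build`. -/
theorem partialProd_eq (hinj : Function.Injective j) (hj : ∀ i, 1 ≤ j i ∧ j i < n)
    (hQ : Q ∈ triplets j) {k : ℕ} (hk : k ≤ n - 1) :
    ((∀ σ, ¬ Pending j Q σ k) ∧ partialProd n j Q k = build n (kindOf j Q) (dirOf j) k ∧
      partialLength j Q k = ∑ r ∈ range k, (kindOf j Q (r + 1)).len) ∨
    (Pending j Q true k ∧ partialProd n j Q k =
        build n (kindOf j Q) (dirOf j) k * simpleRefl (n * 2) (2 * k + 1) ∧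
      partialLength j Q k = (∑ r ∈ range k, (kindOf j Q (r + 1)).len) + 1) ∨
    (Pending j Q false k ∧ partialProd n j Q k =
        simpleRefl (n * 2) (2 * k + 1) * build n (kindOf j Q) (dirOf j) k ∧
      partialLength j Q k = (∑ r ∈ range k, (kindOf j Q (r + 1)).len) + 1) := by
  induction k with
  | zero =>
    left
    refine ⟨fun σ ⟨i, _, i', _, h, _⟩ => ?_, partialProd_zero hj, partialLength_zero hj⟩
    have := hj i
    omega
  | succ k ih =>
    have ih := ih (by omega)
    have hspec := buildSpec_build (n := n) (admissible_kindOf hinj (fun i => (hj i).1) hQ)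
      (k := k) (by omega)
    rw [sum_range_succ]
    by_cases hex : ∃ x, j x = k + 1
    swap
    · -- the letter does not occur
      have hne : ∀ i, j i ≠ k + 1 := fun i hi => hex ⟨i, hi⟩
      have hnp : ∀ σ, ¬ Pending j Q σ k := fun σ hp => by
        obtain ⟨-, x, -, hx⟩ := hp.exists_letter hinj hQ
        exact hne x hx
      have hnp' : ∀ σ, ¬ Pending j Q σ (k + 1) := fun σ ⟨i, hi, i', hn, h1, h2⟩ =>
        hnp σ ⟨i, hi, i', hn, by have := hne i; omega, by omega⟩
      have hκ : kindOf j Q (k + 1) = .absent := kindOf_eq_absent_iff.2 fun i hi => absurd hi (hne i)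
      obtain ⟨-, h1, h2⟩ := ih.resolve_right fun h => h.elim (fun h => hnp _ h.1) fun h => hnp _ h.1
      refine Or.inl ⟨hnp', ?_, ?_⟩
      · rw [partialProd_succ_of_forall_ne hne, h1, build, hκ]
        simp [Kind.elt]
      · rw [partialLength_succ_of_forall_ne hne, h2, hκ]
        rfl
    obtain ⟨x, hx⟩ := hex
    by_cases he : x ∉ Q.Ie
    · have hnp : ∀ σ, ¬ Pending j Q σ k := fun σ hp => by
        obtain ⟨-, y, hy, hy'⟩ := hp.exists_letter hinj hQ
        exact he (hinj (hx.trans hy'.symm) ▸ hy)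
      have hnp' : ∀ σ, ¬ Pending j Q σ (k + 1) := fun σ hp => by
        rw [pending_succ_iff_of_notMem_If hinj hx fun hf => he (hQ.1 hf)] at hp
        exact he (exists_isNeighbor_of_mem_I hinj hQ hp.1).1
      have hκ : kindOf j Q (k + 1) = .absent := hx ▸ kindOf_of_notMem hinj he
      obtain ⟨-, h1, h2⟩ := ih.resolve_right fun h => h.elim (fun h => hnp _ h.1) fun h => hnp _ h.1
      have hlb := letterBlock_of_notMem (j := j) he
      refine Or.inl ⟨hnp', ?_, ?_⟩
      · rw [build, hκ]
        split_ifs with hd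
        · rw [partialProd_succ_of_dirOf hinj hj hx hd, h1, hlb]
          rfl
        · rw [Bool.not_eq_true] at hd
          rw [partialProd_succ_of_not_dirOf hinj hj hx hd, h1, hlb]
          simp [wordProd, Kind.elt]
      · rw [partialLength_succ hinj hx, h2, hlb, hκ]
        rfl
    rw [not_not] at he
    by_cases hf : x ∈ Q.If
    · have hκ : kindOf j Q (k + 1) = .double := hx ▸ kindOf_of_mem_If hQ hf
      have hlb := letterBlock_of_mem_If hQ hf
      have hg : wordProd (n * 2) (letterBlock j Q x) = doublePerm (simpleRefl n (k + 1)) := by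
        rw [hlb, hx, doublePerm_simpleRefl (by omega) (by omega)]
      simp only [fun σ => pending_succ_of_mem_If (σ := σ) hinj hx hf]
      rw [partialLength_succ hinj hx, hlb, build, hκ, Kind.elt, doublePerm_simpleRefl_inv,
        show 2 * (k + 1) + 1 = 2 * k + 3 by ring]
      -- At a position in `I_f`, a pending reflection moves through the double factor, its index
      -- rising by 2, and stays pending.
      have c1 := simpleRefl_mul_doublePerm (n := n) (k := k) (by omega)
      have c2 := doublePerm_mul_simpleRefl (n := n) (k := k) (by omega)
      rcases ih with ⟨hp, h1, h2⟩ | ⟨hp, h1, h2⟩ | ⟨hp, h1, h2⟩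
      · refine Or.inl ⟨hp, ?_, by rw [h2]; rfl⟩
        split_ifs with hd
        · rw [partialProd_succ_of_dirOf hinj hj hx hd, h1, hg]
        · rw [Bool.not_eq_true] at hd
          rw [partialProd_succ_of_not_dirOf hinj hj hx hd, h1, hg]
      · have hd := (hp.exists_letter hinj hQ).1
        refine Or.inr (Or.inl ⟨hp, ?_, by rw [h2]; simp only [Kind.len, List.length]⟩)
        rw [if_pos hd, partialProd_succ_of_dirOf hinj hj hx hd, h1, hg, mul_assoc, c1, mul_assoc]
      · have hd := (hp.exists_letter hinj hQ).1
        refine Or.inr (Or.inr ⟨hp, ?_, by rw [h2]; simp only [Kind.len, List.length]⟩)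
        rw [if_neg (by simp [hd]), partialProd_succ_of_not_dirOf hinj hj hx hd, h1, hg, ← mul_assoc,
          c2, mul_assoc]
    -- a letter of `I_e` outside `I_f`
    have hnext : ∀ σ, Pending j Q σ (k + 1) ↔ x ∈ Q.I ∧ ∃ i', IsNeighbor j σ Q.If Set.univ x i' :=
      fun σ => pending_succ_iff_of_notMem_If hinj hx hf
    -- `Y` is the previous partial product, which is completed by `s_{2k+2}`
    obtain ⟨Y, hY, hYfix, hYb, hYl⟩ : ∃ Y, partialProd n j Q k = Y ∧ FixesFrom Y (2 * k + 2) ∧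
        build n (kindOf j Q) (dirOf j) (k + 1) = (if dirOf j (k + 1) then
          Y * simpleRefl (n * 2) (2 * k + 2) else simpleRefl (n * 2) (2 * k + 2) * Y) ∧
        (∑ r ∈ range k, (kindOf j Q (r + 1)).len) + (kindOf j Q (k + 1)).len =
          partialLength j Q k + 1 := by
      refine ⟨_, rfl, ?_⟩
      have e1 : 2 * k + 2 - 1 = 2 * k + 1 := by omega
      have e2 : 2 * (k + 1) = 2 * k + 2 := by ring
      have hs : FixesFrom (simpleRefl (n * 2) (2 * k + 1)) (2 * k + 2) :=
        fixesFrom_simpleRefl (by omega)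
      have hcyc : ∀ σ, Pending j Q σ k → kindOf j Q (k + 1) = .cyclic := fun σ hp => by
        obtain ⟨i, hi, hn⟩ := (pending_iff_of_notMem_If hinj hx hf).1 hp
        exact hx ▸ kindOf_of_target hinj he hi hn
      rcases ih with ⟨hp, h1, h2⟩ | ⟨hp, h1, h2⟩ | ⟨hp, h1, h2⟩
      · have hκ : kindOf j Q (k + 1) = .simple := by
          rw [← hx]
          refine kindOf_of_not_target hinj he hf fun σ i hi hn => hp σ ?_
          exact (pending_iff_of_notMem_If hinj hx hf).2 ⟨i, hi, hn⟩
        rw [h1, h2, build, hκ]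
        refine ⟨hspec.fixes, ?_, rfl⟩
        simp only [Kind.elt, simpleRefl_inv, e2]
      · have hd := (hp.exists_letter hinj hQ).1
        rw [h1, h2, build, hcyc _ hp, if_pos hd, if_pos hd]
        refine ⟨hspec.fixes.mul hs, ?_, rfl⟩
        simp only [Kind.elt, e1, e2, mul_assoc]
      · have hd := (hp.exists_letter hinj hQ).1
        rw [h1, h2, build, hcyc _ hp, hd]
        refine ⟨hs.mul hspec.fixes, ?_, rfl⟩
        simp only [Kind.elt, e1, e2, mul_inv_rev, simpleRefl_inv, mul_assoc, Bool.false_eq_true,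
          if_false]
    -- A newly pending `s_{2k+3}` commutes with the earlier product `Y`, so the side on which it
    -- remains is independent of the side on which the current factor is multiplied.
    have hcomm : Y * simpleRefl (n * 2) (2 * k + 3) = simpleRefl (n * 2) (2 * k + 3) * Y :=
      hYfix.commute (fixesBelow_simpleRefl (by omega))
    rw [hYl, hYb, partialLength_succ hinj hx]
    rw [show 2 * (k + 1) + 1 = 2 * k + 3 by ring]
    have e3 : 2 * j x = 2 * k + 2 := by omega
    have hstep : partialProd n j Q (k + 1) = if dirOf j (k + 1) then
        Y * wordProd (n * 2) (letterBlock j Q x) else wordProd (n * 2) (letterBlock j Q x) * Y := by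
      split_ifs with hd
      · rw [partialProd_succ_of_dirOf hinj hj hx hd, hY]
      · rw [Bool.not_eq_true] at hd
        rw [partialProd_succ_of_not_dirOf hinj hj hx hd, hY]
    rw [hstep]
    by_cases hI : x ∈ Q.I
    · obtain ⟨-, σ, i', -, hn⟩ := exists_isNeighbor_of_mem_I hinj hQ hI
      have hlb := letterBlock_of_isNeighbor hinj he hI hn
      have hp := (hnext σ).2 ⟨hI, i', hn⟩
      cases σ
      · refine Or.inr (Or.inr ⟨hp, ?_, ?_⟩)
        · simp only [hlb, e3, Bool.false_eq_true, if_false, wordProd, List.map, List.prod_cons,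
            List.prod_nil, mul_one]
          split_ifs
          · rw [← mul_assoc, hcomm, mul_assoc]
          · rw [mul_assoc]
        · rw [hlb]; rfl
      · refine Or.inr (Or.inl ⟨hp, ?_, ?_⟩)
        · simp only [hlb, e3, if_true, wordProd, List.map, List.prod_cons,
            List.prod_nil, mul_one]
          split_ifs
          · rw [mul_assoc]
          · rw [mul_assoc, ← hcomm, mul_assoc]
        · rw [hlb]; rfl
    · have hlb := letterBlock_of_notMem_I (j := j) he hf hI
      refine Or.inl ⟨fun σ hp => hI ((hnext σ).1 hp).1, ?_, ?_⟩
      · simp only [hlb, e3, wordProd, List.map, List.prod_cons, List.prod_nil, mul_one]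
      · rw [hlb]; rfl

theorem not_pending_last (hj : ∀ i, 1 ≤ j i ∧ j i < n) (σ : Bool) : ¬ Pending j Q σ (n - 1) := by
  rintro ⟨i, _, i', _, _, h⟩
  have := hj i'
  omega

theorem qMap_eq_build (hinj : Function.Injective j) (hj : ∀ i, 1 ≤ j i ∧ j i < n)
    (hQ : Q ∈ triplets j) : qMap j n Q = build n (kindOf j Q) (dirOf j) (n - 1) ∧
      (omegaWord j Q).length = ∑ r ∈ range (n - 1), (kindOf j Q (r + 1)).len := by
  have hnp := not_pending_last (Q := Q) hj
  rw [← partialProd_last hj, ← partialLength_last hj]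
  exact ((partialProd_eq hinj hj hQ le_rfl).resolve_right fun h =>
    h.elim (fun h => hnp _ h.1) fun h => hnp _ h.1).2

theorem buildSpec_qMap (hinj : Function.Injective j) (hj : ∀ i, 1 ≤ j i ∧ j i < n)
    (hQ : Q ∈ triplets j) : BuildSpec n (kindOf j Q) (dirOf j) (qMap j n Q) true (n - 1) := by
  rw [(qMap_eq_build hinj hj hQ).1]
  exact buildSpec_build (admissible_kindOf hinj (fun i => (hj i).1) hQ) le_rfl

theorem isReducedWord_omegaWord (hinj : Function.Injective j) (hj : ∀ i, 1 ≤ j i ∧ j i < n)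
    (hQ : Q ∈ triplets j) : IsReducedWord (n * 2) (omegaWord j Q) := by
  refine isReducedWord_of_invNum (isWord_omegaWord hj) ?_
  rw [(qMap_eq_build hinj hj hQ).2]
  exact (buildSpec_qMap hinj hj hQ).invNum_eq

end Product

/-! ### Test elements and block ranks -/

section Tests

variable {n : ℕ} {κ : ℕ → Kind} {dir : ℕ → Bool}

theorem Kind.act_le_rank (κ : Kind) {x : ℕ} (hx : x ≤ 2) : κ.act x ≤ κ.rank := by
  cases κ <;> simp only [Kind.act, Kind.rank] <;> omega

theorem Kind.rank_le_two (κ : Kind) : κ.rank ≤ 2 := by cases κ <;> simp [Kind.rank]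

theorem chainRank_le_two (σ : Bool) (p q : ℕ) : chainRank κ dir σ p q ≤ 2 := by
  induction q with
  | zero => simp [chainRank]
  | succ q ih =>
    rw [chainRank]
    split_ifs
    · exact Kind.rank_le_two _
    · exact (Kind.act_le _ _).trans ih
    · omega

/-- The rank never grows along a chain, and the action of a factor on ranks at most 2 is bounded by
its own rank. Thus every factor on the way gives a bound. -/
theorem chainRank_le_rank (σ : Bool) {p q r : ℕ} (hpr : p ≤ r) (hrq : r ≤ q) :
    chainRank κ dir σ p q ≤ (κ r).rank := by
  induction q with
  | zero => simp [chainRank]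
  | succ q ih =>
    rcases (by omega : (p = q + 1 ∧ r = q + 1) ∨ (p ≤ q ∧ r = q + 1) ∨ (p ≤ q ∧ r ≤ q)) with
      ⟨h1, rfl⟩ | ⟨h1, rfl⟩ | ⟨h1, h2⟩
    · rw [h1, chainRank_self σ (by omega)]
    · by_cases hd : dir (q + 1) = σ
      · rw [chainRank_succ σ h1 hd]
        exact Kind.act_le_rank _ (chainRank_le_two _ _ _)
      · rw [chainRank_succ_of_ne σ h1 hd]
        omega
    · by_cases hd : dir (q + 1) = σ
      · rw [chainRank_succ σ h1 hd]
        exact (Kind.act_le _ _).trans (ih h2)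
      · rw [chainRank_succ_of_ne σ h1 hd]
        omega

theorem dir_eq_of_chainRank_pos {σ : Bool} {p q r : ℕ} (h : 0 < chainRank κ dir σ p q)
    (hpr : p < r) (hrq : r ≤ q) : dir r = σ := by
  induction q with
  | zero => omega
  | succ q ih =>
    by_cases hd : dir (q + 1) = σ
    · rcases (by omega : r = q + 1 ∨ r ≤ q) with rfl | h1
      · exact hd
      · rw [chainRank_succ σ (by omega) hd] at h
        exact ih (h.trans_le (Kind.act_le _ _)) h1
    · rw [chainRank_succ_of_ne σ (by omega) hd] at h
      omega

theorem build_eq_of_absent {a k : ℕ} (hak : a ≤ k)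
    (h : ∀ r, a < r → r ≤ k → κ r = .absent) : build n κ dir k = build n κ dir a := by
  induction k, hak using Nat.le_induction with
  | base => rfl
  | succ k hk ih =>
    rw [build, h _ (by omega) le_rfl, ih fun r h1 h2 => h r h1 (by omega)]
    simp [Kind.elt]

theorem build_eq_of_double {a k : ℕ} (hak : a ≤ k)
    (h : ∀ r, a < r → r ≤ k → κ r = .double ∧ dir r = true) : build n κ dir k =
      build n κ dir a * ((List.range' (a + 1) (k - a)).map fun r =>
        doublePerm (simpleRefl n r)).prod := by
  induction k, hak using Nat.le_induction with
  | base => simp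
  | succ k hk ih =>
    obtain ⟨h1, h2⟩ := h _ (by omega) le_rfl
    rw [build, h1, if_pos h2, ih fun r h1 h2 => h r h1 (by omega), show k + 1 - a = (k - a) + 1 by omega,
      List.range'_concat, List.map_append, List.prod_append, mul_assoc]
    simp only [List.map_cons, List.map_nil, List.prod_cons, List.prod_nil, mul_one, one_mul, Kind.elt]
    rw [show a + 1 + (k - a) = k + 1 by omega]

variable (n) in
-- Each doubled reflection moves the transposition to the next block.
theorem simpleRefl_mul_prod_doublePerm {a m : ℕ} (h : a + m < n) :
    simpleRefl (n * 2) (2 * a + 1) *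
      ((List.range' (a + 1) m).map fun r => doublePerm (simpleRefl n r)).prod =
    ((List.range' (a + 1) m).map fun r => doublePerm (simpleRefl n r)).prod *
      simpleRefl (n * 2) (2 * (a + m) + 1) := by
  induction m with
  | zero => simp
  | succ m ih =>
    rw [List.range'_concat, List.map_append, List.prod_append, ← mul_assoc, ih (by omega)]
    simp only [List.map_cons, List.map_nil, List.prod_cons, List.prod_nil, mul_one, one_mul]
    rw [show a + 1 + m = (a + m) + 1 by ring, mul_assoc, mul_assoc,
      simpleRefl_mul_doublePerm (by omega)]
    rfl

theorem blk_mono {u : Perm (Fin (n * 2))} {p p' q q' : ℕ} (hp : p ≤ p') (hq : q' ≤ q) :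
    blk u p q ≤ blk u p' q' :=
  (rk_mono u _ (by omega)).trans (rk_anti u (by omega) _)

/-- A single factor. -/
theorem single_le_iff {a : ℕ} (ha : 1 ≤ a) (han : a < n) {κ₀ : Kind} (hκ : κ₀ ≠ .cyclic)
    {u : Perm (Fin (n * 2))} :
    BruhatLE (κ₀.elt n a) u ↔ κ₀.rank ≤ blk u a a := by
  -- The factor is viewed as an assembled product with all other factors absent, so that its block
  -- ranks vanish off the entry `(a, a)`.
  let κ : ℕ → Kind := fun r => if r = a then κ₀ else .absent
  let dir : ℕ → Bool := fun _ => true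
  have hadm : Admissible κ dir := by
    intro k hk
    simp only [κ] at hk
    split_ifs at hk with h
    exact absurd hk hκ
  have hspec := buildSpec_build (n := n) hadm le_rfl
  have hb : build n κ dir (n - 1) = κ₀.elt n a := by
    obtain ⟨a, rfl⟩ : ∃ k, a = k + 1 := ⟨a - 1, by omega⟩
    rw [build_eq_of_absent (a := a + 1) (by omega) fun r h1 h2 => if_neg (by omega), build,
      build_eq_of_absent (a := 0) (by omega) fun r h1 h2 => if_neg (by omega)]
    simp [build, dir]
  rw [hb] at hspec
  have hself : chainRank κ dir true a a = κ₀.rank := by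
    rw [chainRank_self true ha]
    simp [κ]
  have hle : (∀ {σ p q}, p ≤ q → q < n → κ₀.rank ≤ blk u a a →
      chainRank κ dir σ p q ≤ blk u p q) := by
    intro σ p q hpq hq h
    by_cases hpa : p = a ∧ q = a
    · obtain ⟨rfl, rfl⟩ := hpa
      rwa [chainRank_self σ ha, show κ q = κ₀ by simp [κ]]
    · obtain ⟨r, h1, h2, h3⟩ : ∃ r, p ≤ r ∧ r ≤ q ∧ r ≠ a := by
        by_cases hp : p = a
        · exact ⟨q, hpq, le_rfl, fun h => hpa ⟨hp, h⟩⟩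
        · exact ⟨p, le_rfl, hpq, hp⟩
      have := chainRank_le_rank (κ := κ) (dir := dir) σ h1 h2
      rw [show κ r = .absent by simp [κ, h3]] at this
      simp only [Kind.rank] at this
      omega
  constructor
  · intro h
    have := h.blk_le a a
    rwa [hspec.blk_eq a a le_rfl (by omega), hself] at this
  · intro h
    refine bruhatLE_of_blk_le hspec.mem (fun p q hp hq => ?_) fun p q hp hq => ?_
    · rw [hspec.blk_eq p q hp (by omega)]
      exact hle hp hq h
    · rw [hspec.blk_inv_eq p q hp (by omega)]
      rcases (by omega : p = q ∨ p < q) with rfl | hlt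
      · rw [blk_self_inv]
        exact hle le_rfl hq h
      · by_contra hc
        have := dir_eq_of_chainRank_pos (r := q) (by omega : 0 < chainRank κ dir (!true) p q) hlt le_rfl
        simp [dir] at this

theorem simpleRefl_le_iff {a : ℕ} (ha : 1 ≤ a) (han : a < n) {u : Perm (Fin (n * 2))} :
    BruhatLE (simpleRefl (n * 2) (2 * a)) u ↔ 1 ≤ blk u a a :=
  single_le_iff (κ₀ := .simple) ha han (by simp)

theorem doublePerm_simpleRefl_le_iff {a : ℕ} (ha : 1 ≤ a) (han : a < n) {u : Perm (Fin (n * 2))} :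
    BruhatLE (doublePerm (simpleRefl n a)) u ↔ 2 ≤ blk u a a :=
  single_le_iff (κ₀ := .double) ha han (by simp)

/-- The kinds of factors for `rightTest`. -/
def testKind (a b r : ℕ) : Kind :=
  if r = a then .simple else if r = b then .cyclic else if a < r ∧ r < b then .double else .absent

theorem chainRank_testKind {a b : ℕ} (ha : 1 ≤ a) (hab : a < b) :
    chainRank (testKind a b) (fun _ => true) true a (b - 1) = 1 := by
  rw [chainRank_eq_rank_of_double ha (by omega)]
  · simp [testKind, Kind.rank]
  · intro r h1 h2
    simp only [testKind, and_true]
    rw [if_neg (by omega), if_neg (by omega), if_pos (by omega)]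

/-- Moving `s_{2a+1}` through the double factors turns it into `s_{2b-1}`, which combines with
`s_{2b}` to the cyclic factor at `b`. -/
theorem buildSpec_rightTest {a b : ℕ} (ha : 1 ≤ a) (hab : a < b) (hb : b < n) :
    BuildSpec n (testKind a b) (fun _ => true) (rightTest n a b) true (n - 1) := by
  have hadm : Admissible (testKind a b) (fun _ => true) := by
    intro k hk
    have : k + 1 = b := by
      unfold testKind at hk
      split_ifs at hk
      assumption
    refine ⟨a, by omega, ?_⟩
    rw [← chainRank_testKind ha hab, ← this]
    rfl
  have hspec := buildSpec_build (n := n) hadm le_rfl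
  suffices build n (testKind a b) (fun _ => true) (n - 1) = rightTest n a b by rwa [this] at hspec
  obtain ⟨b, rfl⟩ : ∃ k, b = k + 1 := ⟨b - 1, by omega⟩
  rw [build_eq_of_absent (a := b + 1) (by omega)]
  swap
  · intro r h1 h2
    rw [testKind, if_neg (by omega), if_neg (by omega), if_neg (by omega)]
  rw [build, if_pos rfl, build_eq_of_double (a := a) (by omega)]
  swap
  · intro r h1 h2
    rw [testKind, if_neg (by omega), if_neg (by omega), if_pos (by omega)]
    exact ⟨rfl, rfl⟩
  obtain ⟨a, rfl⟩ : ∃ k, a = k + 1 := ⟨a - 1, by omega⟩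
  rw [build, build_eq_of_absent (a := 0) (by omega)]
  swap
  · intro r h1 h2
    rw [testKind, if_neg (by omega), if_neg (by omega), if_neg (by omega)]
  have e1 : testKind (a + 1) (b + 1) (a + 1) = .simple := by simp [testKind]
  have e2 : testKind (a + 1) (b + 1) (b + 1) = .cyclic := by
    rw [testKind, if_neg (by omega), if_pos rfl]
  have key := simpleRefl_mul_prod_doublePerm n (a := a + 1) (m := b - (a + 1)) (by omega)
  rw [show 2 * (a + 1 + (b - (a + 1))) + 1 = 2 * (b + 1) - 1 by omega] at key
  rw [rightTest, e1, e2, if_pos rfl, build, one_mul, show b + 1 - (a + 1) - 1 = b - (a + 1) by omega,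
    mul_assoc (simpleRefl (n * 2) (2 * (a + 1))) (simpleRefl (n * 2) (2 * (a + 1) + 1)), key]
  simp only [Kind.elt, mul_assoc]

theorem leftTest_eq_inv (n a b : ℕ) : leftTest n a b = (rightTest n a b)⁻¹ := by
  simp only [leftTest, rightTest, mul_inv_rev, simpleRefl_inv, List.prod_inv_reverse, List.map_map,
    ← List.map_reverse, mul_assoc]
  congr 2
  exact congrArg List.prod (List.map_congr_left fun r _ => (doublePerm_simpleRefl_inv n r).symm)

theorem one_le_blk_of_rightTest_le {a b : ℕ} (ha : 1 ≤ a) (hab : a < b) (hb : b < n)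
    {u : Perm (Fin (n * 2))} (h : BruhatLE (rightTest n a b) u) : 1 ≤ blk u a b := by
  have hspec := buildSpec_rightTest ha hab hb
  have := h.blk_le a b
  rw [hspec.blk_eq a b hab.le (by omega)] at this
  obtain ⟨b, rfl⟩ : ∃ k, b = k + 1 := ⟨b - 1, by omega⟩
  have h1 := chainRank_testKind ha hab
  rw [Nat.add_sub_cancel] at h1
  rw [chainRank_succ true (by omega) rfl, h1, testKind, if_neg (by omega), if_pos rfl] at this
  exact this

/-- The block ranks of the test element vanish unless `a ≤ p ≤ q ≤ b`. They are at most 1 on the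
border `p = a` or `q = b`, where those of `u` dominate `blk u a b`; in the interior they are at most
2, which `hu` covers. -/
theorem rightTest_le_iff {a b : ℕ} (ha : 1 ≤ a) (hab : a < b) (hb : b < n) {u : Perm (Fin (n * 2))}
    (hu : ∀ p q, a < p → p ≤ q → q < b → 2 ≤ blk u p q) :
    BruhatLE (rightTest n a b) u ↔ 1 ≤ blk u a b := by
  have hspec := buildSpec_rightTest ha hab hb
  refine ⟨one_le_blk_of_rightTest_le ha hab hb, fun h => ?_⟩
  have hle : ∀ {σ p q}, p ≤ q → chainRank (testKind a b) (fun _ => true) σ p q ≤ blk u p q := by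
    intro σ p q hpq
    have h0 := chainRank_le_two (κ := testKind a b) (dir := fun _ => true) σ p q
    have h1 := chainRank_le_rank (κ := testKind a b) (dir := fun _ => true) σ le_rfl hpq
    have h2 := chainRank_le_rank (κ := testKind a b) (dir := fun _ => true) σ hpq le_rfl
    by_cases hin : a ≤ p ∧ q ≤ b
    · have h3 : blk u a b ≤ blk u p q := blk_mono hin.1 hin.2
      by_cases hpa : p = a
      · rw [testKind, if_pos hpa] at h1
        simp only [Kind.rank] at h1
        omega
      by_cases hqb : q = b
      · rw [testKind, if_neg (by omega), if_pos hqb] at h2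
        simp only [Kind.rank] at h2
        omega
      have := hu p q (by omega) hpq (by omega)
      omega
    · by_cases hp : a ≤ p
      · rw [testKind, if_neg (by omega), if_neg (by omega), if_neg (by omega)] at h2
        simp only [Kind.rank] at h2
        omega
      · rw [testKind, if_neg (by omega), if_neg (by omega), if_neg (by omega)] at h1
        simp only [Kind.rank] at h1
        omega
  refine bruhatLE_of_blk_le hspec.mem (fun p q hp hq => ?_) fun p q hp hq => ?_
  · rw [hspec.blk_eq p q hp (by omega)]
    exact hle hp
  · rw [hspec.blk_inv_eq p q hp (by omega)]
    rcases (by omega : p = q ∨ p < q) with rfl | hlt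
    · rw [blk_self_inv]
      exact hle le_rfl
    · by_contra hc
      have := dir_eq_of_chainRank_pos (r := q)
        (by omega : 0 < chainRank (testKind a b) (fun _ => true) (!true) p q) hlt le_rfl
      simp at this

end Tests

/-! ### Block ranks below a Boolean element are determined by few of them -/

section Determined

variable {n : ℕ}

/-- Supermodularity of block ranks. -/
theorem blk_add_blk_le (u : Perm (Fin (n * 2))) {p p' q q' : ℕ} (hp : p ≤ p') (hq : q ≤ q') :
    blk u p q + blk u p' q' ≤ blk u p' q + blk u p q' := by
  simp only [blk, rk, ← sum_add_distrib]
  refine sum_le_sum fun i _ => ?_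
  split_ifs <;> omega

variable (n) in
/-- The properties of the block ranks of an element below a Boolean element. -/
structure ChainBounded (dir : ℕ → Bool) (σ : Bool) (v : Perm (Fin (n * 2))) : Prop where
  le_two : ∀ {p q}, p ≤ q → q < n → blk v p q ≤ 2
  dir_eq : ∀ {p q r}, p ≤ q → q < n → 0 < blk v p q → p < r → r ≤ q → dir r = σ
  inv_dir_eq : ∀ {p q r}, p ≤ q → q < n → 0 < blk v⁻¹ p q → p < r → r ≤ q → dir r = !σ

variable {dir : ℕ → Bool} {σ : Bool} {v v' : Perm (Fin (n * 2))}

/-- This is supermodularity for rows `p`, `q + 1` and columns `q`, `q + 1`. The entry `(q + 1, q)`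
equals 2 plus an inverse rank, which vanishes because the direction at `q + 1` is `σ`. -/
theorem ChainBounded.blk_add_le (hv : ChainBounded n dir σ v) {p q : ℕ} (hpq : p ≤ q)
    (hq : q + 1 < n) (hd : dir (q + 1) = σ) :
    blk v p q + blk v (q + 1) (q + 1) ≤ 2 + blk v p (q + 1) := by
  have h1 := blk_add_blk_le v (show p ≤ q + 1 by omega) (Nat.le_add_right q 1)
  have h2 := blk_swap v (p := q + 1) (q := q) (by omega) (by omega)
  have h3 : blk v⁻¹ q (q + 1) = 0 := by
    by_contra hc
    have := hv.inv_dir_eq (r := q + 1) (Nat.le_add_right q 1) hq (by omega) (by omega) le_rfl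
    simp [hd] at this
  omega

theorem ChainBounded.two_le_blk (hv : ChainBounded n dir σ v) {p q : ℕ} (hpq : p ≤ q) (hq : q < n)
    (h2 : ∀ r, p ≤ r → r ≤ q → blk v r r = 2) (hd : ∀ r, p < r → r ≤ q → dir r = σ) :
    2 ≤ blk v p q := by
  induction q, hpq using Nat.le_induction with
  | base => exact (h2 p le_rfl le_rfl).ge
  | succ q hpq ih =>
    have ih := ih (by omega) (fun r h h' => h2 r h (by omega)) fun r h h' => hd r h (by omega)
    have := hv.blk_add_le hpq hq (hd _ (by omega) le_rfl)
    rw [h2 (q + 1) (by omega) le_rfl] at this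
    omega

/-- The block ranks are determined by the diagonal ones and by the ones between neighbors. -/
theorem ChainBounded.blk_le_blk (hv : ChainBounded n dir σ v) (hv' : ChainBounded n dir σ v')
    (hdiag : ∀ q < n, blk v q q = blk v' q q)
    (hnbr : ∀ a b, a < b → b < n → blk v a a < 2 → blk v b b < 2 →
      (∀ r, a < r → r < b → blk v r r = 2) → 1 ≤ blk v a b → 1 ≤ blk v' a b)
    {p q : ℕ} (hpq : p ≤ q) (hq : q < n) : blk v p q ≤ blk v' p q := by
  induction q, hpq using Nat.le_induction with
  | base => exact (hdiag p hq).le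
  | succ q hpq ih =>
    have ih := ih (by omega)
    rcases Nat.eq_zero_or_pos (blk v p (q + 1)) with h0 | hpos
    · omega
    have hdir := fun r h h' => hv.dir_eq (r := r) (show p ≤ q + 1 by omega) hq hpos h h'
    have h1 := hv'.blk_add_le hpq hq (hdir _ (by omega) le_rfl)
    have h2 : blk v p (q + 1) ≤ blk v p q := blk_mono le_rfl (Nat.le_add_right q 1)
    have h3 : blk v p (q + 1) ≤ blk v (q + 1) (q + 1) := blk_mono (by omega) le_rfl
    have h4 := hdiag (q + 1) hq
    have h5 := hv.le_two (le_refl (q + 1)) hq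
    -- If the diagonal rank is 2, then `h1` says that the rank of `v'` does not drop from column `q`
    -- to `q + 1`. Otherwise the diagonal rank is 1, and failure leaves only ranks 1 at `(p, q)` and
    -- 0 at `(p, q + 1)` for `v'`.
    by_cases hD : blk v (q + 1) (q + 1) = 2
    · omega
    by_contra hcon
    have h6 : blk v' p q = 1 := by omega
    -- the last letter before `q + 1` which is moved across by at most one point
    let P : ℕ → Prop := fun r => p ≤ r ∧ blk v r r ≠ 2
    have hex : ∃ r ≤ q, P r := by
      by_contra hno
      push Not at hno
      have := hv'.two_le_blk hpq (by omega) (fun r hr hr' => by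
        rw [← hdiag r (by omega)]
        by_contra hne
        exact hno r hr' ⟨hr, hne⟩) fun r hr hr' => hdir r hr (by omega)
      omega
    obtain ⟨r, hrq, hr⟩ := hex
    classical
    let a := Nat.findGreatest P q
    have ha : P a := Nat.findGreatest_spec hrq hr
    have haq : a ≤ q := Nat.findGreatest_le q
    have hmax : ∀ r, a < r → r < q + 1 → blk v r r = 2 := fun r hr hr' => by
      by_contra hne
      exact Nat.findGreatest_is_greatest hr (by omega) ⟨by have := ha.1; omega, hne⟩
    have h7 : blk v p (q + 1) ≤ blk v a (q + 1) := blk_mono ha.1 le_rfl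
    have h8 := hv.le_two (le_refl a) (by omega)
    have h9 := ha.2
    have h10 := hnbr a (q + 1) (by omega) hq (by omega) (by omega) hmax (by omega)
    -- The four entries in rows `p`, `a` and columns `q`, `q + 1` contradict supermodularity: the
    -- left side is at least 1 + 1, the right side at most 1 + 0.
    have h11 := blk_add_blk_le v' ha.1 (Nat.le_add_right q 1)
    have h12 : blk v' a q ≤ blk v' a a := blk_mono le_rfl haq
    have h13 := hdiag a (by omega)
    omega

end Determined

/-! ### The two maps are mutually inverse -/

section Main

variable {n l : ℕ} {j : Fin l → ℕ}

/-- The permutation or its inverse. -/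
def orient {m : ℕ} (σ : Bool) (u : Perm (Fin m)) : Perm (Fin m) := if σ then u else u⁻¹

theorem blk_orient_self (σ : Bool) (u : Perm (Fin (n * 2))) (q : ℕ) :
    blk (orient σ u) q q = blk u q q := by
  cases σ
  · exact blk_self_inv u q
  · rfl

theorem bruhatLE_inv_iff {m : ℕ} {u v : Perm (Fin m)} : BruhatLE u⁻¹ v ↔ BruhatLE u v⁻¹ :=
  ⟨fun h => by simpa using h.inv, fun h => by simpa using h.inv⟩

theorem mem_setE_iff (hj : ∀ i, 1 ≤ j i ∧ j i < n) {u : Perm (Fin (n * 2))} {i : Fin l} :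
    i ∈ setE j u ↔ 1 ≤ blk u (j i) (j i) :=
  simpleRefl_le_iff (hj i).1 (hj i).2

theorem mem_setF_iff (hj : ∀ i, 1 ≤ j i ∧ j i < n) {u : Perm (Fin (n * 2))} {i : Fin l} :
    i ∈ setF j u ↔ 2 ≤ blk u (j i) (j i) :=
  doublePerm_simpleRefl_le_iff (hj i).1 (hj i).2

theorem mem_pMap_I_iff {u : Perm (Fin (n * 2))} {i : Fin l} :
    i ∈ (pMap j u).I ↔ ∃ σ i', IsNeighbor j σ (setF j u) Set.univ i i' ∧
      BruhatLE (rightTest n (j i) (j i')) (orient σ u) := by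
  simp [pMap, setRight, setLeft, IsNeighbor, orient, leftTest_eq_inv, bruhatLE_inv_iff, or_comm]

theorem BuildSpec.blk_orient_eq {κ : ℕ → Kind} {dir : ℕ → Bool} {u : Perm (Fin (n * 2))}
    (h : BuildSpec n κ dir u true (n - 1)) (σ : Bool) {p q : ℕ} (hpq : p ≤ q) (hq : q < n) :
    blk (orient σ u) p q = chainRank κ dir σ p q := by
  cases σ
  · exact h.blk_inv_eq p q hpq (by omega)
  · exact h.blk_eq p q hpq (by omega)

/-- The diagonal ranks of `𝐪 Q` are the ranks of its factors and recover `I_e` and `I_f`. Between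
neighbors, the rank is the action of the last factor on the rank of the first, which is positive
exactly when the first position is in `I`. -/
theorem pMap_qMap (hinj : Function.Injective j) (hj : ∀ i, 1 ≤ j i ∧ j i < n) {Q : Triplet l}
    (hQ : Q ∈ triplets j) : pMap j (qMap j n Q) = Q := by
  have hspec := buildSpec_qMap hinj hj hQ
  have hdiag : ∀ i, blk (qMap j n Q) (j i) (j i) = (kindOf j Q (j i)).rank := fun i => by
    have := hj i
    rw [hspec.blk_eq _ _ le_rfl (by omega), chainRank_self true this.1]
  have hrank : ∀ i, (i ∉ Q.Ie ∧ (kindOf j Q (j i)).rank = 0) ∨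
      (i ∈ Q.Ie ∧ i ∉ Q.If ∧ (kindOf j Q (j i)).rank = 1) ∨
      (i ∈ Q.Ie ∧ i ∈ Q.If ∧ (kindOf j Q (j i)).rank = 2) := fun i => by
    by_cases he : i ∈ Q.Ie
    · by_cases hf : i ∈ Q.If
      · exact Or.inr (Or.inr ⟨he, hf, by rw [kindOf_of_mem_If hQ hf]; rfl⟩)
      · exact Or.inr (Or.inl ⟨he, hf, rank_kindOf hinj he hf⟩)
    · exact Or.inl ⟨he, by rw [kindOf_of_notMem hinj he]; rfl⟩
  have hF : setF j (qMap j n Q) = Q.If := by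
    ext i
    rw [mem_setF_iff hj, hdiag]
    rcases hrank i with ⟨h1, h2⟩ | ⟨h1, h2, h3⟩ | ⟨h1, h2, h3⟩
    · simpa [h2] using fun h => h1 (hQ.1 h)
    · simp [h2, h3]
    · simp [h2, h3]
  ext i
  · change i ∈ setE j _ ↔ _
    rw [mem_setE_iff hj, hdiag]
    rcases hrank i with ⟨h1, h2⟩ | ⟨h1, h2, h3⟩ | ⟨h1, h2, h3⟩
    · simp [h1, h2]
    · simp [h1, h3]
    · simp [h1, h3]
  · rw [mem_pMap_I_iff, hF]
    have htest : ∀ {σ i'}, IsNeighbor j σ Q.If Set.univ i i' →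
        (BruhatLE (rightTest n (j i) (j i')) (orient σ (qMap j n Q)) ↔
          1 ≤ (kindOf j Q (j i')).act (kindOf j Q (j i)).rank) := by
      intro σ i' h
      have h' := (isNeighbor_iff hinj σ _ _ i i').1 h
      obtain ⟨-, -, h1, h2, h3, h4⟩ := h'
      have hi := hj i
      have hi' := hj i'
      rw [rightTest_le_iff hi.1 h1 hi'.2, hspec.blk_orient_eq σ h1.le hi'.2]
      · have hc := chainRank_kindOf hinj hQ hi.1 h
        obtain ⟨b, hb⟩ : ∃ k, j i' = k + 1 := ⟨j i' - 1, by omega⟩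
        rw [hb, Nat.add_sub_cancel] at hc
        rw [hb, chainRank_succ σ (by omega) (h2 _ (by omega) (by omega)), hc]
      · intro p q hp hpq hq
        have hdouble : ∀ r, j i < r → r < j i' → kindOf j Q r = .double := fun r hr hr' => by
          obtain ⟨x, rfl⟩ := h3 r (by omega) (by omega)
          exact kindOf_of_mem_If hQ (h4 x hr hr')
        rw [hspec.blk_orient_eq σ hpq (by omega),
          chainRank_eq_rank_of_double (by omega) hpq fun r hr hr' =>
            ⟨hdouble r (by omega) (by omega), h2 r (by omega) (by omega)⟩,
          hdouble p hp (by omega)]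
        rfl
    constructor
    · rintro ⟨σ, i', h, hle⟩
      rw [htest h] at hle
      have h' := (isNeighbor_iff hinj σ _ _ i i').1 h
      have he' : i' ∈ Q.Ie := by
        by_contra he'
        rw [kindOf_of_notMem hinj he'] at hle
        simp [Kind.act] at hle
      have hr := hrank i
      by_contra hI
      -- If `i ∉ I`, uniqueness of the source makes the factor at `i'` simple, and it takes the rank
      -- at most 1 of the factor at `i` to 0.
      rw [kindOf_of_not_target hinj he' h'.2.1.2] at hle
      · have := h'.1.2
        simp only [Kind.act] at hle
        rcases hr with ⟨h1, h2⟩ | ⟨h1, h2, h3⟩ | ⟨h1, h2, h3⟩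
        · omega
        · omega
        · exact this h2
      · intro τ i₀ hi₀ hn
        exact hI (hn.source_unique hinj h ▸ hi₀)
    · intro hi
      obtain ⟨he, σ, i', he', h⟩ := exists_isNeighbor_of_mem_I hinj hQ hi
      refine ⟨σ, i', h, (htest h).2 ?_⟩
      rw [kindOf_of_target hinj he' hi h, rank_kindOf hinj he
        ((isNeighbor_iff hinj σ _ _ i i').1 h).1.2]
      rfl
  · exact Set.ext_iff.1 hF i

/-- The triplet of `w̃`. -/
def fullTriplet (l : ℕ) : Triplet l := ⟨Set.univ, ∅, Set.univ⟩

theorem fullTriplet_mem (j : Fin l → ℕ) : fullTriplet l ∈ triplets j :=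
  ⟨subset_rfl, Set.empty_subset _⟩

theorem doublePerm_wordProd (v : List ℕ) :
    doublePerm (wordProd n v) = (v.map fun k => doublePerm (simpleRefl n k)).prod := by
  induction v with
  | nil => exact doublePerm_one n
  | cons k v ih => rw [wordProd_cons, doublePerm_mul, ih, List.map_cons, List.prod_cons]

theorem doublePerm_eq_qMap (hj : ∀ i, 1 ≤ j i ∧ j i < n) :
    doublePerm (wordProd n (List.ofFn j)) = qMap j n (fullTriplet l) := by
  rw [doublePerm_wordProd, qMap, omegaWord, wordProd_flatMap, List.ofFn_eq_map, List.map_map]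
  congr 1
  refine List.map_congr_left fun i _ => ?_
  rw [letterBlock_of_mem_If (fullTriplet_mem j) trivial, ← doublePerm_simpleRefl (hj i).1 (hj i).2]
  rfl

theorem qMap_mem_biReducedBelow (hinj : Function.Injective j) (hj : ∀ i, 1 ≤ j i ∧ j i < n)
    {Q : Triplet l} (hQ : Q ∈ triplets j) :
    qMap j n Q ∈ biReducedBelow (qMap j n (fullTriplet l)) := by
  have h1 := buildSpec_qMap hinj hj hQ
  have h2 := buildSpec_qMap hinj hj (fullTriplet_mem j)
  have hκ : ∀ k, kindOf j Q k = .absent ∨ kindOf j (fullTriplet l) k = .double := by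
    intro k
    by_cases hk : ∃ i, j i = k
    · obtain ⟨i, rfl⟩ := hk
      exact Or.inr (kindOf_of_mem_If (fullTriplet_mem j) trivial)
    · exact Or.inl (kindOf_eq_absent_iff.2 fun i hi => absurd ⟨i, hi⟩ hk)
  refine ⟨h1.mem, bruhatLE_of_blk_le h1.mem (fun p q hp hq => ?_) fun p q hp hq => ?_⟩
  · rw [h1.blk_eq p q hp (by omega), h2.blk_eq p q hp (by omega)]
    exact chainRank_mono hκ _ _ _
  · rw [h1.blk_inv_eq p q hp (by omega), h2.blk_inv_eq p q hp (by omega)]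
    exact chainRank_mono hκ _ _ _

section Below

variable {u u' : Perm (Fin (n * 2))}

theorem blk_orient_le (hinj : Function.Injective j) (hj : ∀ i, 1 ≤ j i ∧ j i < n)
    (hu : BruhatLE u (qMap j n (fullTriplet l))) (σ : Bool) {p q : ℕ} (hpq : p ≤ q) (hq : q < n) :
    blk (orient σ u) p q ≤ chainRank (kindOf j (fullTriplet l)) (dirOf j) σ p q := by
  rw [← (buildSpec_qMap hinj hj (fullTriplet_mem j)).blk_orient_eq σ hpq hq]
  cases σ
  · exact hu.inv.blk_le p q
  · exact hu.blk_le p q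

/-- The bounds are inherited from `w̃`, whose block ranks are at most 2 and are positive off the
diagonal only along letters of constant direction. -/
theorem chainBounded_orient (hinj : Function.Injective j) (hj : ∀ i, 1 ≤ j i ∧ j i < n)
    (hu : BruhatLE u (qMap j n (fullTriplet l))) (σ : Bool) :
    ChainBounded n (dirOf j) σ (orient σ u) where
  le_two hpq hq := (blk_orient_le hinj hj hu σ hpq hq).trans (chainRank_le_two _ _ _)
  dir_eq hpq hq h hr hr' :=
    dir_eq_of_chainRank_pos (h.trans_le (blk_orient_le hinj hj hu σ hpq hq)) hr hr'
  inv_dir_eq hpq hq h hr hr' := by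
    have e : (orient σ u)⁻¹ = orient (!σ) u := by cases σ <;> simp [orient]
    rw [e] at h
    exact dir_eq_of_chainRank_pos (h.trans_le (blk_orient_le hinj hj hu _ hpq hq)) hr hr'

theorem exists_letter_of_blk_pos (hinj : Function.Injective j) (hj : ∀ i, 1 ≤ j i ∧ j i < n)
    (hu : BruhatLE u (qMap j n (fullTriplet l))) {σ : Bool} {p q r : ℕ} (hq : q < n)
    (h : 0 < blk (orient σ u) p q) (hpr : p ≤ r) (hrq : r ≤ q) : ∃ i, j i = r := by
  have h1 := blk_orient_le hinj hj hu σ (hpr.trans hrq) hq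
  have h2 := chainRank_le_rank (κ := kindOf j (fullTriplet l)) (dir := dirOf j) σ hpr hrq
  by_contra hne
  rw [kindOf_eq_absent_iff.2 fun i hi => absurd ⟨i, hi⟩ hne] at h2
  simp only [Kind.rank] at h2
  omega

/-- The definition of `𝐩` uses neighbors in the whole word, whereas `𝒯` requires both ends in `I_e`.
A positive rank at `(a, b)` forces positive diagonal ranks at `a` and `b`, which supplies this. -/
theorem pMap_mem_triplets (hinj : Function.Injective j) (hj : ∀ i, 1 ≤ j i ∧ j i < n)
    (u : Perm (Fin (n * 2))) : pMap j u ∈ triplets j := by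
  refine ⟨fun i hi => ?_, fun i hi => ?_⟩
  · have := (mem_setF_iff hj).1 hi
    exact (mem_setE_iff hj).2 (by omega)
  · obtain ⟨σ, i', h, hle⟩ := mem_pMap_I_iff.1 hi
    have h' := (isNeighbor_iff hinj σ _ _ i i').1 h
    have h1 := one_le_blk_of_rightTest_le (hj i).1 h'.2.2.1 (hj i').2 hle
    refine exists_isNeighbor_iff.2 ⟨σ, i', (isNeighbor_iff hinj σ _ _ i i').2
      ⟨⟨(mem_setE_iff hj).2 ?_, h'.1.2⟩, ⟨(mem_setE_iff hj).2 ?_, h'.2.1.2⟩, h'.2.2⟩⟩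
    · rw [← blk_orient_self σ]
      exact h1.trans (blk_mono le_rfl h'.2.2.1.le)
    · rw [← blk_orient_self σ]
      exact h1.trans (blk_mono h'.2.2.1.le le_rfl)

/-- The sets `I_e` and `I_f` fix the diagonal ranks, since these are at most 2 and vanish at missing
letters. A positive rank between two letters as in `ChainBounded.blk_le_blk` makes them neighbors
that pass the test, so it is recorded in `I`. -/
theorem blk_orient_le_of_pMap_eq (hinj : Function.Injective j) (hj : ∀ i, 1 ≤ j i ∧ j i < n)
    (hu : BruhatLE u (qMap j n (fullTriplet l))) (hu' : BruhatLE u' (qMap j n (fullTriplet l)))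
    (h : pMap j u = pMap j u') (σ : Bool) {p q : ℕ} (hpq : p ≤ q) (hq : q < n) :
    blk (orient σ u) p q ≤ blk (orient σ u') p q := by
  have hb := chainBounded_orient hinj hj hu
  have hb' := chainBounded_orient hinj hj hu'
  have hE : ∀ i, i ∈ setE j u ↔ i ∈ setE j u' := fun i =>
    Set.ext_iff.1 (congrArg Triplet.Ie h) i
  have hF : setF j u = setF j u' := congrArg Triplet.If h
  have hdiag : ∀ q < n, blk u q q = blk u' q q := by
    intro q hq
    by_cases hex : ∃ i, j i = q
    · obtain ⟨i, rfl⟩ := hex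
      have h1 := hE i
      have h2 := Set.ext_iff.1 hF i
      rw [mem_setE_iff hj, mem_setE_iff hj] at h1
      rw [mem_setF_iff hj, mem_setF_iff hj] at h2
      have h3 : blk u (j i) (j i) ≤ 2 := (hb true).le_two le_rfl hq
      have h4 : blk u' (j i) (j i) ≤ 2 := (hb' true).le_two le_rfl hq
      omega
    · have h1 : ¬ 0 < blk u q q := fun h0 =>
        hex (exists_letter_of_blk_pos hinj hj hu (σ := true) hq h0 le_rfl le_rfl)
      have h2 : ¬ 0 < blk u' q q := fun h0 =>
        hex (exists_letter_of_blk_pos hinj hj hu' (σ := true) hq h0 le_rfl le_rfl)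
      omega
  refine (hb σ).blk_le_blk (hb' σ) (fun q hq => ?_) (fun a b hab hbn ha hb2 hint h1 => ?_) hpq hq
  · rw [blk_orient_self, blk_orient_self, hdiag q hq]
  · have hletter := fun r hr hr' => exists_letter_of_blk_pos (r := r) hinj hj hu hbn h1 hr hr'
    have hdir := fun r hr hr' => (hb σ).dir_eq (r := r) hab.le hbn h1 hr hr'
    obtain ⟨i, rfl⟩ := hletter a le_rfl hab.le
    obtain ⟨i', rfl⟩ := hletter b hab.le le_rfl
    rw [blk_orient_self] at ha hb2
    have hn : IsNeighbor j σ (setF j u) Set.univ i i' := by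
      refine (isNeighbor_iff hinj σ _ _ i i').2 ⟨⟨trivial, fun hi => ?_⟩, ⟨trivial, fun hi => ?_⟩,
        hab, hdir, hletter, fun x hx hx' => (mem_setF_iff hj).2 ?_⟩
      · have := (mem_setF_iff hj).1 hi
        omega
      · have := (mem_setF_iff hj).1 hi
        omega
      · rw [← blk_orient_self σ]
        exact (hint _ hx hx').ge
    have htest : BruhatLE (rightTest n (j i) (j i')) (orient σ u) := by
      rw [rightTest_le_iff (hj i).1 hab hbn]
      · exact h1
      · intro p q hp hpq hq
        exact (hb σ).two_le_blk hpq (by omega) (fun r hr hr' => hint r (by omega) (by omega))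
          fun r hr hr' => hdir r (by omega) (by omega)
    have hI : i ∈ (pMap j u').I := h ▸ mem_pMap_I_iff.2 ⟨σ, i', hn, htest⟩
    obtain ⟨τ, i'', hn', htest'⟩ := mem_pMap_I_iff.1 hI
    rw [← hF] at hn'
    obtain ⟨rfl, rfl⟩ := hn.target_unique hinj hn'
    exact one_le_blk_of_rightTest_le (hj i).1 hab hbn htest'

theorem injOn_pMap (hinj : Function.Injective j) (hj : ∀ i, 1 ≤ j i ∧ j i < n) :
    Set.InjOn (pMap (n := n) j) (biReducedBelow (qMap j n (fullTriplet l))) := by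
  intro u hu u' hu' h
  have key := fun σ p q hpq hq => le_antisymm
    (blk_orient_le_of_pMap_eq hinj hj hu.2 hu'.2 h σ (p := p) (q := q) hpq hq)
    (blk_orient_le_of_pMap_eq hinj hj hu'.2 hu.2 h.symm σ hpq hq)
  exact eq_of_blk_eq hu.1 hu'.1 (key true) (key false)

end Below

end Main

end BooleanDC

theorem mainTheorem4 (n l : ℕ) (j : Fin l → ℕ) (hj : ∀ i, 1 ≤ j i ∧ j i < n)
    (hinj : Function.Injective j) (w : Equiv.Perm (Fin n))
    (hw : w = BooleanDC.wordProd n (List.ofFn j)) :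
    Set.BijOn (BooleanDC.pMap (n := n) j) (BooleanDC.biReducedBelow (BooleanDC.doublePerm w))
        (BooleanDC.triplets j) ∧
      Set.BijOn (BooleanDC.qMap j n) (BooleanDC.triplets j)
        (BooleanDC.biReducedBelow (BooleanDC.doublePerm w)) ∧
      Set.InvOn (BooleanDC.qMap j n) (BooleanDC.pMap (n := n) j)
        (BooleanDC.biReducedBelow (BooleanDC.doublePerm w)) (BooleanDC.triplets j) ∧
      ∀ Q ∈ BooleanDC.triplets j, BooleanDC.IsReducedWord (n * 2) (BooleanDC.omegaWord j Q) := by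
  rw [hw, BooleanDC.doublePerm_eq_qMap hj]
  have hp : Set.MapsTo (BooleanDC.pMap (n := n) j)
      (BooleanDC.biReducedBelow (BooleanDC.qMap j n (BooleanDC.fullTriplet l)))
      (BooleanDC.triplets j) := fun u _ => BooleanDC.pMap_mem_triplets hinj hj u
  have hq : Set.MapsTo (BooleanDC.qMap j n) (BooleanDC.triplets j)
      (BooleanDC.biReducedBelow (BooleanDC.qMap j n (BooleanDC.fullTriplet l))) :=
    fun Q hQ => BooleanDC.qMap_mem_biReducedBelow hinj hj hQ
  have hright : Set.RightInvOn (BooleanDC.qMap j n) (BooleanDC.pMap (n := n) j)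
      (BooleanDC.triplets j) := fun Q hQ => BooleanDC.pMap_qMap hinj hj hQ
  -- Both `u` and `𝐪 (𝐩 u)` are bi-reduced, lie below `w̃` and have the same image under `𝐩`.
  have hleft : Set.LeftInvOn (BooleanDC.qMap j n) (BooleanDC.pMap (n := n) j)
      (BooleanDC.biReducedBelow (BooleanDC.qMap j n (BooleanDC.fullTriplet l))) := fun u hu =>
    BooleanDC.injOn_pMap hinj hj (hq (hp hu)) hu (hright (hp hu))
  have hinv : Set.InvOn (BooleanDC.qMap j n) (BooleanDC.pMap (n := n) j)
      (BooleanDC.biReducedBelow (BooleanDC.qMap j n (BooleanDC.fullTriplet l)))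
      (BooleanDC.triplets j) := ⟨hleft, hright⟩
  exact ⟨hinv.bijOn hp hq, hinv.symm.bijOn hq hp, hinv, fun Q hQ =>
    BooleanDC.isReducedWord_omegaWord hinj hj hQ⟩
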